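/- Let $n\ge 3$ be an odd integer, let $i$ be a positive integer with $\gcd(i,n)=1$, and put $q=2^n$ and $s=2^{2i}-2^i+1$ (the Kasami exponent). Then $\gcd(2^i+1,q-1)=1$, and $\frac{1}{2^i+1}$ denotes the inverse of $2^i+1$ modulo $q-1$, taken in $\{1,\dots,q-2\}$. Let $$B=\mathrm{GF}(q)\setminus\left\{\left((x+1)^s+x^s+1\right)^{\frac{1}{2^i+1}} : x\in \mathrm{GF}(q)\right\}.$$ Let $\mathrm{GA}_1(q)$ be the group of all permutations $x\mapsto ax+b$ of $\mathrm{GF}(q)$ with $a\in\mathrm{GF}(q)\setminus\{0\}$ and $b\in\mathrm{GF}(q)$, acting on subsets of $\mathrm{GF}(q)$ by $\pi(B)=\{\pi(x):x\in B\}$. Then $\mathrm{GF}(q)$ together with the orbit $\{\pi(B):\pi\in \mathrm{GA}_1(q)\}$ as its set of blocks (without multiplicity) is a $3$-$\left(q,\frac q2,\frac{q(q-4)}8\right)$ design; that is, every block has exactly $\frac q2$ points, and every $3$-subset of $\mathrm{GF}(q)$ is contained in exactly $\frac{q(q-4)}8$ blocks. Moreover, the stabilizer $\{\pi\in\mathrm{GA}_1(q):\pi(B)=B\}$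 is trivial. -/

import Mathlib

open scoped Pointwise

/-- `(P, 𝓑)` is a `t`-`(v, k, l)` design: `P` is a set of `v ≥ 1` points, the blocks are
`k`-subsets of `P` with `1 ≤ t ≤ k ≤ v`, and every `t`-subset of `P` is contained in exactly
`l` blocks. The blocks form a set, so they are counted without multiplicity. -/
structure IsDesign {P : Type*} [Finite P] (𝓑 : Set (Set P)) (t v k l : ℕ) : Prop where
  card_points : Nat.card P = v
  one_le_t : 1 ≤ t
  t_le_k : t ≤ k
  k_le_v : k ≤ v
  card_block : ∀ b ∈ 𝓑, b.ncard = k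
  card_containing : ∀ T : Set P, T.ncard = t → {b ∈ 𝓑 | T ⊆ b}.ncard = l

/-- The general affine group of degree one over `F`: the group of all permutations
`x ↦ a * x + b` of `F` with `a ≠ 0`. -/
def generalAffineGroup (F : Type*) [Field F] : Subgroup (Equiv.Perm F) where
  carrier := {π | ∃ a b : F, a ≠ 0 ∧ ∀ x, π x = a * x + b}
  one_mem' := ⟨1, 0, one_ne_zero, fun x => by simp⟩
  mul_mem' := by
    rintro π ρ ⟨a, b, ha, hπ⟩ ⟨c, d, hc, hρ⟩
    refine ⟨a * c, a * d + b, mul_ne_zero ha hc, fun x => ?_⟩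
    rw [Equiv.Perm.mul_apply, hρ, hπ]
    ring
  inv_mem' := by
    rintro π ⟨a, b, ha, hπ⟩
    refine ⟨a⁻¹, -(a⁻¹ * b), inv_ne_zero ha, fun x => ?_⟩
    rw [Equiv.Perm.inv_eq_iff_eq, hπ]
    field_simp
    ring

/-- The exponent `1 / e` of a power function on a field with `q` elements: the inverse of `e`
modulo `q - 1`, represented by a natural number less than `q - 1`. -/
def invExponent (q e : ℕ) : ℕ := ((e : ZMod (q - 1))⁻¹).val

theorem mul_invExponent_modEq {q e : ℕ} (hq : 1 < q) (h : Nat.Coprime e (q - 1)) :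
    e * invExponent q e ≡ 1 [MOD q - 1] := by
  have : NeZero (q - 1) := ⟨by omega⟩
  rw [← ZMod.natCast_eq_natCast_iff]
  rw [Nat.cast_mul, invExponent, ZMod.natCast_zmod_val, ZMod.coe_mul_inv_eq_one e h, Nat.cast_one]

/-- The exponent `1 / (2 ^ i + 1)` exists on the field with `2 ^ n` elements, for `n` odd and
`i` prime to `n`. -/
theorem coprime_two_pow_add_one {n i : ℕ} (hn : Odd n) (hi : Nat.Coprime i n) :
    Nat.Coprime (2 ^ i + 1) (2 ^ n - 1) := by
  have h2 : Nat.Coprime (2 * i) n := Nat.Coprime.mul_left (Nat.coprime_two_left.mpr hn) hi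
  have h3 : Nat.Coprime (2 ^ (2 * i) - 1) (2 ^ n - 1) := by
    have := Nat.pow_sub_one_gcd_pow_sub_one 2 (2 * i) n
    rw [Nat.Coprime, this, h2, pow_one]
  refine Nat.Coprime.coprime_dvd_left ⟨2 ^ i - 1, ?_⟩ h3
  rw [← Nat.sq_sub_sq, ← pow_mul, mul_comm i 2, one_pow]

/-- The Kasami exponent `2 ^ (2 * i) - 2 ^ i + 1`. -/
def kasamiExponent (i : ℕ) : ℕ := 2 ^ (2 * i) - 2 ^ i + 1

/-- The base block: the complement in `F`, a field with `2 ^ n` elements, of the image of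
`x ↦ ((x + 1) ^ s + x ^ s + 1) ^ (1 / (2 ^ i + 1))`, `s` being the Kasami exponent. -/
def kasamiBlock (F : Type*) [Field F] (n i : ℕ) : Set F :=
  (Set.range fun x : F =>
    ((x + 1) ^ kasamiExponent i + x ^ kasamiExponent i + 1) ^ invExponent (2 ^ n) (2 ^ i + 1))ᶜ

/-! Write `q = 2 ^ n`, `Q = 2 ^ k` (with `k = i` at the end), `χ = (-1) ^ Tr`, and let `f =
blockSign` be the sign that is `-1` on the block, with Walsh transform `W y = ∑ w, f w * χ (y * w)`.

Counting blocks through three points amounts to counting affine maps that carry the points into the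
base block, provided distinct maps give distinct blocks. Each membership is `(1 - f) / 2`. Expanding
the product of three such factors, the terms of degree one and two sum to zero because `f` has sum
zero, so everything rests on the triple correlation, which by Fourier inversion is `∑ y, W (c₁ * y)
* W (c₂ * y) * W ((c₁ + c₂) * y)`.

The main input is the theorem of Dillon and Dobbertin: `W y = C (y ^ (Q + 1))` for `y ≠ 0`, where `C
= cubicSum` is the transform of a cubic. It is reached by comparing exponents `k` and `1`: the sum
`dicksonSum χ k` has as Fourier transform the number of preimages under the Dickson polynomials of
degrees `Q + 1` and `Q - 1` together (`sum_mul_dicksonSum`), and this number does not depend on `k`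
(`ncard_dicksonSet_eq`). For `k = 1` the sum is evaluated directly. Parseval then shows that the
Kasami function is two-to-one, which identifies its transform with `W` away from zero.

With `W` in cubic form, the triple correlation is a character sum over a diagonal cubic `a₁ x³ + a₂
y³ + a₃ z³ = 0`. By homogeneity it vanishes as soon as the cubic meets the plane `x + y + z = 0` in
`q` points; there the form is a sum of two cubes, and cubing is bijective, so the intersection is a
line.

Finally `W y ^ 2 = q * (1 - χ (ρ y))` with `ρ y ^ 3 = y ^ (Q + 1)`. This square is sharp enough to
exclude every nontrivial affine symmetry. -/

/-- `χ` is the nontrivial additive character `x ↦ (-1) ^ Tr x` of a finite field of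
characteristic two and odd degree, characterised by the properties that are used here. -/
structure IsTraceSign {F : Type*} [Field F] (χ : AddChar F ℤ) : Prop where
  isPrimitive : χ.IsPrimitive
  map_sq : ∀ x, χ (x ^ 2) = χ x
  map_one : χ 1 = -1

theorem exists_isTraceSign (F : Type*) [Field F] [Finite F] [CharP F 2] {n : ℕ} (hn : Odd n)
    (hF : Nat.card F = 2 ^ n) : ∃ χ : AddChar F ℤ, IsTraceSign χ := by
  let : Algebra (ZMod 2) F := ZMod.algebra F 2
  have hz : ((-1 : ℤ)) ^ 2 = 1 := by norm_num
  let ψ : AddChar (ZMod 2) ℤ := AddChar.zmodChar 2 hz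
  have hψ0 : ψ 0 = 1 := AddChar.map_zero_eq_one ψ
  have hψ1 : ψ 1 = -1 := by
    change (-1 : ℤ) ^ (1 : ZMod 2).val = -1
    rw [ZMod.val_one, pow_one]
  let χ : AddChar F ℤ := ψ.compAddMonoidHom (Algebra.trace (ZMod 2) F).toAddMonoidHom
  have hχ : ∀ x, χ x = ψ (Algebra.trace (ZMod 2) F x) := fun _ => rfl
  have hone : χ 1 = -1 := by
    have hr : Module.finrank (ZMod 2) F = n := by
      have h := Module.natCard_eq_pow_finrank (K := ZMod 2) (V := F)
      rw [hF, Nat.card_zmod] at h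
      exact (Nat.pow_right_injective le_rfl h).symm
    have h1 : Algebra.trace (ZMod 2) F 1 = 1 := by
      have h := Algebra.trace_algebraMap (R := ZMod 2) (S := F) 1
      rw [map_one, hr, nsmul_one] at h
      rw [h, ZMod.natCast_eq_one_iff_odd.mpr hn]
    rw [hχ, h1, hψ1]
  refine ⟨χ, AddChar.IsPrimitive.of_ne_one ?_, fun x => ?_, hone⟩
  · intro h
    rw [h, AddChar.one_apply] at hone
    norm_num at hone
  · have h := Algebra.trace_eq_of_algEquiv (FiniteField.frobeniusAlgEquivOfAlgebraic (ZMod 2) F) x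
    have h2 : FiniteField.frobeniusAlgEquivOfAlgebraic (ZMod 2) F x = x ^ 2 := by
      simp [ZMod.card]
    rw [h2] at h
    rw [hχ, hχ, h]

/-! ### Powers in characteristic two -/

section CharTwo

variable {F : Type*} [Field F] [CharP F 2]

theorem add_eq_zero_iff_eq_of_char_two {x y : F} : x + y = 0 ↔ x = y := by
  rw [← CharTwo.sub_eq_add, sub_eq_zero]

theorem add_pow_two_pow_of_char_two (x y : F) (k : ℕ) :
    (x + y) ^ 2 ^ k = x ^ 2 ^ k + y ^ 2 ^ k := add_pow_char_pow x y 2 k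

theorem sq_eq_one_iff_of_char_two {x : F} : x ^ 2 = 1 ↔ x = 1 := by
  refine ⟨fun h => ?_, fun h => by rw [h, one_pow]⟩
  have h1 : (x + 1) ^ 2 = 0 := by rw [CharTwo.add_sq, h, one_pow, CharTwo.add_self_eq_zero]
  exact add_eq_zero_iff_eq_of_char_two.mp ((pow_eq_zero_iff two_ne_zero).mp h1)

theorem sq_bijective_of_char_two [Finite F] : Function.Bijective fun x : F => x ^ 2 := by
  refine Finite.injective_iff_bijective.mp fun x y h => ?_
  have h2 : (x + y) ^ 2 = 0 := by
    rw [CharTwo.add_sq, add_eq_zero_iff_eq_of_char_two]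
    exact h
  exact add_eq_zero_iff_eq_of_char_two.mp (pow_eq_zero_iff two_ne_zero |>.mp h2)

end CharTwo

theorem pow_bijective_of_coprime {F : Type*} [Field F] [Fintype F] {e : ℕ} (he : e ≠ 0)
    (h : e.Coprime (Fintype.card F - 1)) : Function.Bijective fun x : F => x ^ e := by
  refine Finite.injective_iff_bijective.mp fun x y hxy => ?_
  have hxy' : x ^ e = y ^ e := hxy
  rcases eq_or_ne y 0 with rfl | hy
  · rwa [zero_pow he, pow_eq_zero_iff he] at hxy'
  have hx : x ≠ 0 := by
    rintro rfl
    rw [zero_pow he] at hxy'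
    exact hy ((pow_eq_zero_iff he).mp hxy'.symm)
  have h1 : (x / y) ^ e = 1 := by rw [div_pow, hxy', div_self (pow_ne_zero _ hy)]
  have h2 := FiniteField.pow_card_sub_one_eq_one _ (div_ne_zero hx hy)
  have h3 := pow_gcd_eq_one.mpr ⟨h1, h2⟩
  rw [h, pow_one] at h3
  exact (div_eq_one_iff_eq hy).mp h3

/-! ### Character sums and Fourier inversion -/

namespace IsTraceSign

variable {F : Type*} [Field F] {χ : AddChar F ℤ}

theorem map_pow_two_pow (hχ : IsTraceSign χ) (k : ℕ) (x : F) : χ (x ^ 2 ^ k) = χ x := by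
  induction k with
  | zero => rw [pow_zero, pow_one]
  | succ k ih => rw [pow_succ, pow_mul, hχ.map_sq, ih]

theorem map_mul_self [CharP F 2] (χ : AddChar F ℤ) (x : F) : χ x * χ x = 1 := by
  rw [← AddChar.map_add_eq_mul, CharTwo.add_self_eq_zero, AddChar.map_zero_eq_one]

variable [Fintype F] [DecidableEq F]

theorem sum_mul (hχ : IsTraceSign χ) (u : F) :
    ∑ g, χ (g * u) = if u = 0 then (Fintype.card F : ℤ) else 0 := by
  rw [AddChar.sum_mulShift u hχ.isPrimitive]
  push_cast
  rfl

theorem sum_eq_zero (hχ : IsTraceSign χ) : ∑ g, χ g = 0 := by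
  simpa using hχ.sum_mul 1

/-- Since `χ (b * x) = χ (b ^ 2 * x ^ 2)`, the summand is an additive character in the variable `x ^
2`. -/
theorem sum_quadratic [CharP F 2] (hχ : IsTraceSign χ) (a b : F) :
    ∑ x, χ (a * x ^ 2 + b * x) = if a = b ^ 2 then (Fintype.card F : ℤ) else 0 := by
  have h : ∀ x, χ (a * x ^ 2 + b * x) = χ (x ^ 2 * (a + b ^ 2)) := fun x => by
    rw [AddChar.map_add_eq_mul, ← hχ.map_sq (b * x), ← AddChar.map_add_eq_mul]
    congr 1
    ring
  rw [Fintype.sum_congr _ _ h, sq_bijective_of_char_two.sum_comp fun y => χ (y * (a + b ^ 2)),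
    hχ.sum_mul]
  simp only [add_eq_zero_iff_eq_of_char_two]

/-- The number of solutions of an Artin-Schreier equation. -/
theorem card_sq_add_self_eq [CharP F 2] (hχ : IsTraceSign χ) (u : F) :
    ((Finset.univ.filter fun x : F => x ^ 2 + x = u).card : ℤ) = 1 + χ u := by
  have hq : (Fintype.card F : ℤ) ≠ 0 := Nat.cast_ne_zero.mpr Fintype.card_ne_zero
  refine mul_left_cancel₀ hq ?_
  have h1 : (Fintype.card F : ℤ) * ((Finset.univ.filter fun x : F => x ^ 2 + x = u).card : ℤ)
      = ∑ x, ∑ g, χ (g * (x ^ 2 + x + u)) := by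
    simp only [hχ.sum_mul, add_eq_zero_iff_eq_of_char_two, ← Finset.sum_filter,
      Finset.sum_const, nsmul_eq_mul, mul_comm]
  have h2 : ∀ g, ∑ x, χ (g * (x ^ 2 + x + u)) =
      (if g = g ^ 2 then (Fintype.card F : ℤ) else 0) * χ (g * u) := fun g => by
    rw [← hχ.sum_quadratic, Finset.sum_mul]
    refine Fintype.sum_congr _ _ fun x => ?_
    rw [← AddChar.map_add_eq_mul]
    congr 1
    ring
  have h3 : (Finset.univ.filter fun g : F => g = g ^ 2) = {0, 1} := by
    ext g
    simp only [Finset.mem_filter_univ, Finset.mem_insert, Finset.mem_singleton]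
    rw [eq_comm, sq]
    exact IsIdempotentElem.iff_eq_zero_or_one
  rw [h1, Finset.sum_comm, Fintype.sum_congr _ _ h2]
  simp only [ite_mul, zero_mul, ← Finset.sum_filter, h3]
  rw [Finset.sum_pair zero_ne_one, zero_mul, AddChar.map_zero_eq_one, one_mul]
  ring

theorem eq_of_sum_mul_eq [CharP F 2] (hχ : IsTraceSign χ) {f h : F → ℤ}
    (H : ∀ g, ∑ m, χ (g * m) * f m = ∑ m, χ (g * m) * h m) (m : F) : f m = h m := by
  have hq : (Fintype.card F : ℤ) ≠ 0 := Nat.cast_ne_zero.mpr Fintype.card_ne_zero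
  have inv : ∀ f : F → ℤ, ∑ g, χ (g * m) * ∑ x, χ (g * x) * f x = Fintype.card F * f m := by
    intro f
    simp only [Finset.mul_sum]
    rw [Finset.sum_comm]
    have : ∀ x, ∑ g, χ (g * m) * (χ (g * x) * f x) =
        if x = m then Fintype.card F * f m else 0 := fun x => by
      simp only [← mul_assoc, ← AddChar.map_add_eq_mul, ← mul_add, ← Finset.sum_mul, hχ.sum_mul,
        add_eq_zero_iff_eq_of_char_two, ite_mul, zero_mul]
      split_ifs with h1 h2 h2
      · rw [h1]
      · exact absurd h1.symm h2
      · exact absurd h2.symm h1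
      · rfl
    rw [Fintype.sum_congr _ _ this, Finset.sum_ite_eq' Finset.univ m, if_pos (Finset.mem_univ m)]
  exact mul_left_cancel₀ hq (by rw [← inv f, ← inv h]; simp only [H])

end IsTraceSign

/-! ### Counting roots of unity with a prescribed power -/

theorem exists_pow_eq_of_gcd_eq {K : Type*} [Field K] {e e' ε : ℕ} (hε : 0 < ε)
    (h : e.gcd ε = e'.gcd ε) {v w : K} (hw : w ^ e = v) (hw1 : w ^ ε = 1) :
    ∃ u : K, u ^ e' = v ∧ u ^ ε = 1 := by
  have hw0 : w ≠ 0 := by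
    rintro rfl
    rw [zero_pow hε.ne'] at hw1
    exact zero_ne_one hw1
  obtain ⟨c, hc⟩ : e'.gcd ε ∣ e := h ▸ Nat.gcd_dvd_left e ε
  have hb := Nat.gcd_eq_gcd_ab e' ε
  refine ⟨w ^ ((c : ℤ) * e'.gcdA ε), ?_, ?_⟩
  · rw [← zpow_natCast, ← zpow_mul]
    have h1 : (c : ℤ) * e'.gcdA ε * e' = e + ε * (-(c * e'.gcdB ε)) := by
      have h2 : (e : ℤ) = (e'.gcd ε : ℤ) * c := by exact_mod_cast hc
      rw [h2, hb]
      ring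
    rw [h1, zpow_add₀ hw0, zpow_mul, zpow_natCast, zpow_natCast, hw, hw1, one_zpow, mul_one]
  · rw [← zpow_natCast, ← zpow_mul, mul_comm, zpow_mul, zpow_natCast, hw1, one_zpow]

/-- Each set, if nonempty, is a coset of the same group: the roots of unity of order dividing `e.gcd
ε`. Bézout shows that one is nonempty exactly when the other is. -/
theorem ncard_pow_eq_of_gcd_eq {K : Type*} [Field K] {e e' ε : ℕ} (hε : 0 < ε)
    (h : e.gcd ε = e'.gcd ε) (v : K) :
    {w : K | w ^ e = v ∧ w ^ ε = 1}.ncard = {w : K | w ^ e' = v ∧ w ^ ε = 1}.ncard := by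
  have ne0 : ∀ w : K, w ^ ε = 1 → w ≠ 0 := by
    rintro _ hw1 rfl
    rw [zero_pow hε.ne'] at hw1
    exact zero_ne_one hw1
  by_cases hT : ∃ w : K, w ^ e = v ∧ w ^ ε = 1
  · obtain ⟨w, hw, hw1⟩ := hT
    obtain ⟨u, hu, hu1⟩ := exists_pow_eq_of_gcd_eq hε h hw hw1
    have hw0 := ne0 w hw1
    have hu0 := ne0 u hu1
    have key : ∀ {a b : ℕ} {x y z : K}, a.gcd ε = b.gcd ε → x ^ ε = 1 → y ^ ε = 1 → z ^ ε = 1 →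
        x ^ a = v → y ^ a = v → z ^ b = v → (x * (y⁻¹ * z)) ^ b = v ∧
          (x * (y⁻¹ * z)) ^ ε = 1 := by
      intro a b x y z hab hx1 hy1 hz1 hx hy hz
      have hv0 : v ≠ 0 := hy ▸ pow_ne_zero _ (ne0 y hy1)
      have h1 : (x * y⁻¹) ^ a = 1 := by rw [mul_pow, inv_pow, hx, hy, mul_inv_cancel₀ hv0]
      have h2 : (x * y⁻¹) ^ ε = 1 := by rw [mul_pow, inv_pow, hx1, hy1, inv_one, mul_one]
      have h3 : (x * y⁻¹) ^ b = 1 := (pow_gcd_eq_one.mp (hab ▸ pow_gcd_eq_one.mpr ⟨h1, h2⟩)).1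
      rw [← mul_assoc, mul_pow (x * y⁻¹), mul_pow (x * y⁻¹), h3, h2, hz, hz1, one_mul, one_mul]
      exact ⟨rfl, rfl⟩
    refine Set.ncard_congr (fun x _ => x * (w⁻¹ * u)) ?_ ?_ ?_
    · rintro x ⟨hx, hx1⟩
      exact key h hx1 hw1 hu1 hx hw hu
    · intro x y _ _ hxy
      exact mul_right_cancel₀ (mul_ne_zero (inv_ne_zero hw0) hu0) hxy
    · rintro y ⟨hy, hy1⟩
      refine ⟨y * (u⁻¹ * w), key h.symm hy1 hu1 hw1 hy hu hw, ?_⟩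
      field_simp
  · have h1 : {w : K | w ^ e = v ∧ w ^ ε = 1} = ∅ :=
      Set.eq_empty_of_forall_notMem fun w hw => hT ⟨w, hw⟩
    have h2 : {w : K | w ^ e' = v ∧ w ^ ε = 1} = ∅ :=
      Set.eq_empty_of_forall_notMem fun w hw => hT (exists_pow_eq_of_gcd_eq hε h.symm hw.1 hw.2)
    rw [h1, h2]

theorem finite_setOf_pow_eq_and_pow_eq_one {K : Type*} [Field K] {e ε : ℕ} (hε : 0 < ε) (v : K) :
    {w : K | w ^ e = v ∧ w ^ ε = 1}.Finite :=
  (Polynomial.nthRootsFinset ε (1 : K)).finite_toSet.subset fun _ hw =>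
    (Polynomial.mem_nthRootsFinset hε 1).mpr hw.2

theorem two_pow_sub_one_coprime {k n : ℕ} (h : k.Coprime n) :
    (2 ^ k - 1).Coprime (2 ^ n - 1) := by
  rw [Nat.Coprime, Nat.pow_sub_one_gcd_pow_sub_one, h, pow_one]

theorem gcd_two_pow_add_one_eq {k n a : ℕ} (hn : Odd n) (h : k.Coprime n)
    (ha : a ∣ 2 ^ (2 * k) - 1) : a.gcd (2 ^ n + 1) = a.gcd 3 := by
  have h3 : 3 ∣ 2 ^ n + 1 := by simpa using hn.nat_add_dvd_pow_add_pow 2 1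
  have h4 : (2 ^ (2 * k) - 1).gcd (2 ^ (2 * n) - 1) = 3 := by
    rw [Nat.pow_sub_one_gcd_pow_sub_one, Nat.gcd_mul_left, h]
    rfl
  have h5 : 2 ^ n + 1 ∣ 2 ^ (2 * n) - 1 :=
    ⟨2 ^ n - 1, by rw [← Nat.sq_sub_sq, ← pow_mul, mul_comm n 2, one_pow]⟩
  refine Nat.dvd_antisymm (Nat.dvd_gcd (Nat.gcd_dvd_left _ _) ?_)
    (Nat.gcd_dvd_gcd_of_dvd_right a h3)
  rw [← h4]
  exact Nat.dvd_gcd ((Nat.gcd_dvd_left _ _).trans ha) ((Nat.gcd_dvd_right _ _).trans h5)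

/-- Modulo `2 ^ n - 1` all four gcds are `1`. Modulo `2 ^ n + 1` only the factor `3` can be shared,
and the parity of `k` decides which of `2 ^ k ± 1` it divides. The swap is harmless later because
both degrees are counted together. -/
theorem two_pow_gcd_eq_or {k n ε : ℕ} (hn : Odd n) (h : k.Coprime n)
    (hε : ε = 2 ^ n - 1 ∨ ε = 2 ^ n + 1) :
    ((2 ^ k + 1).gcd ε = (2 ^ 1 + 1).gcd ε ∧ (2 ^ k - 1).gcd ε = (2 ^ 1 - 1).gcd ε) ∨
      ((2 ^ k + 1).gcd ε = (2 ^ 1 - 1).gcd ε ∧ (2 ^ k - 1).gcd ε = (2 ^ 1 + 1).gcd ε) := by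
  have h1 : (1 : ℕ).Coprime n := Nat.coprime_one_left n
  rcases hε with rfl | rfl
  · left
    rw [coprime_two_pow_add_one hn h, coprime_two_pow_add_one hn h1,
      two_pow_sub_one_coprime h, two_pow_sub_one_coprime h1]
    exact ⟨rfl, rfl⟩
  · have hsq : ∀ m : ℕ, 2 ^ (2 * m) - 1 = (2 ^ m + 1) * (2 ^ m - 1) := fun m => by
      rw [← Nat.sq_sub_sq, ← pow_mul, mul_comm m 2, one_pow]
    rw [gcd_two_pow_add_one_eq hn h ⟨_, hsq k⟩, gcd_two_pow_add_one_eq hn h1 ⟨_, hsq 1⟩,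
      gcd_two_pow_add_one_eq hn h ⟨_, (hsq k).trans (mul_comm _ _)⟩,
      gcd_two_pow_add_one_eq hn h1 ⟨_, (hsq 1).trans (mul_comm _ _)⟩]
    have hpos := Nat.one_le_two_pow (n := k)
    have hmod : ∀ a : ℕ, a.gcd 3 = (a % 3).gcd 3 := fun a => by rw [Nat.gcd_comm, Nat.gcd_rec]
    have h4 : ∀ m : ℕ, 4 ^ m % 3 = 1 := fun m => by rw [Nat.pow_mod]; simp
    rcases Nat.even_or_odd' k with ⟨m, rfl | rfl⟩
    · right
      have h5 : 2 ^ (2 * m) % 3 = 1 := by rw [pow_mul]; exact h4 m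
      have h6 : (2 ^ (2 * m) + 1) % 3 = 2 := by omega
      have h7 : (2 ^ (2 * m) - 1) % 3 = 0 := by omega
      rw [hmod (_ + 1), h6, hmod (2 ^ (2 * m) - 1), h7]
      decide
    · left
      have h5 : 2 ^ (2 * m + 1) % 3 = 2 := by
        have := h4 m
        rw [pow_succ, pow_mul]
        norm_num
        omega
      have h6 : (2 ^ (2 * m + 1) + 1) % 3 = 0 := by omega
      have h7 : (2 ^ (2 * m + 1) - 1) % 3 = 1 := by omega
      rw [hmod (_ + 1), h6, hmod (_ - 1), h7]
      decide

/-! ### Sums of an element and its inverse -/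

theorem add_inv_eq_add_inv_iff {K : Type*} [Field K] {x y : K} (hx : x ≠ 0) (hy : y ≠ 0) :
    x + x⁻¹ = y + y⁻¹ ↔ x = y ∨ x * y = 1 := by
  have h : x + x⁻¹ - (y + y⁻¹) = (x - y) * (x * y - 1) * (x * y)⁻¹ := by field_simp; ring
  rw [← sub_eq_zero, h, mul_eq_zero, mul_eq_zero, sub_eq_zero, sub_eq_zero,
    or_iff_left (inv_ne_zero (mul_ne_zero hx hy))]

theorem exists_add_inv_eq {K : Type*} [Field K] [IsAlgClosed K] (x : K) :
    ∃ w : K, w ≠ 0 ∧ w + w⁻¹ = x := by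
  open Polynomial in
  have hd : (X ^ 2 - C x * X + 1 : K[X]).degree = 2 := by compute_degree!
  obtain ⟨w, hw⟩ := IsAlgClosed.exists_root _ (hd.trans_ne two_ne_zero)
  have hw' : w ^ 2 - x * w + 1 = 0 := by simpa using hw
  have hw0 : w ≠ 0 := by
    rintro rfl
    norm_num at hw'
  refine ⟨w, hw0, ?_⟩
  field_simp
  linear_combination hw'

theorem mem_range_algebraMap_of_pow_card {F K : Type*} [Field F] [Fintype F] [Field K]
    [Algebra F K] {z : K} (hz : z ^ Fintype.card F = z) : ∃ x : F, algebraMap F K x = z := by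
  classical
  let S : Finset K := Finset.univ.map ⟨algebraMap F K, (algebraMap F K).injective⟩
  let p : Polynomial K := Polynomial.X ^ Fintype.card F - Polynomial.X
  have hp : p ≠ 0 := FiniteField.X_pow_card_sub_X_ne_zero K Fintype.one_lt_card
  have hmem : ∀ y : K, y ∈ p.roots.toFinset ↔ y ^ Fintype.card F = y := fun y => by
    rw [Multiset.mem_toFinset, Polynomial.mem_roots hp]
    simp [p, sub_eq_zero]
  have hS : S = p.roots.toFinset := by
    refine Finset.eq_of_subset_of_card_le (fun y hy => ?_) ?_
    · obtain ⟨x, -, rfl⟩ := Finset.mem_map.mp hy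
      rw [hmem]
      change algebraMap F K x ^ _ = algebraMap F K x
      rw [← map_pow, FiniteField.pow_card]
    · refine (Multiset.toFinset_card_le _).trans ((Polynomial.card_roots' p).trans ?_)
      rw [Finset.card_map, FiniteField.X_pow_card_sub_X_natDegree_eq K Fintype.one_lt_card]
      exact le_rfl
  have hzS : z ∈ S := by rw [hS, hmem, hz]
  obtain ⟨x, -, hx⟩ := Finset.mem_map.mp hzS
  exact ⟨x, hx⟩

theorem add_inv_pow_card_eq_self_iff {K : Type*} [Field K] [CharP K 2] {w : K} (hw : w ≠ 0)
    (n : ℕ) : (w + w⁻¹) ^ 2 ^ n = w + w⁻¹ ↔ w ^ (2 ^ n - 1) = 1 ∨ w ^ (2 ^ n + 1) = 1 := by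
  have h : w ^ 2 ^ n = w ^ (2 ^ n - 1) * w := by
    rw [← pow_succ, Nat.sub_add_cancel Nat.one_le_two_pow]
  rw [add_pow_two_pow_of_char_two, inv_pow, add_inv_eq_add_inv_iff (pow_ne_zero _ hw) hw,
    ← pow_succ, h, mul_eq_right₀ hw]

/-! ### Preimages under Dickson polynomials -/

/-- The factorization `D_{Q+1}(X)`, `D_{Q-1}(X)` of `g ^ 2 + X ^ (Q + 1) * g + X ^ (2 * Q) + X ^ 2`
at `X = w + w⁻¹`, with the reciprocal `B` of `X` as variable. -/
theorem dickson_factorization {K : Type*} [Field K] [CharP K 2] {w : K} (hw : w ≠ 0)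
    (hX : w + w⁻¹ ≠ 0) (k : ℕ) (g : K) :
    g * (w + w⁻¹)⁻¹ ^ (2 ^ k + 1) + (g * (w + w⁻¹)⁻¹ ^ (2 ^ k + 1)) ^ 2 +
      ((w + w⁻¹)⁻¹) ^ 2 + ((w + w⁻¹)⁻¹ ^ 2 ^ k) ^ 2 = 0 ↔
    g = w ^ (2 ^ k + 1) + (w ^ (2 ^ k + 1))⁻¹ ∨ g = w ^ (2 ^ k - 1) + (w ^ (2 ^ k - 1))⁻¹ := by
  have hW := pow_ne_zero (2 ^ k) hw
  have h1 : w ^ (2 ^ k - 1) = w ^ 2 ^ k * w⁻¹ := by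
    rw [eq_mul_inv_iff_mul_eq₀ hw, ← pow_succ, Nat.sub_add_cancel Nat.one_le_two_pow]
  have hXQ : (w + w⁻¹) ^ 2 ^ k = w ^ 2 ^ k + (w ^ 2 ^ k)⁻¹ := by
    rw [add_pow_two_pow_of_char_two, inv_pow]
  have hXQ0 : w ^ 2 ^ k + (w ^ 2 ^ k)⁻¹ ≠ 0 := hXQ ▸ pow_ne_zero _ hX
  have h2 : (2 : K) = 0 := CharTwo.two_eq_zero
  rw [h1]
  simp only [pow_succ _ (2 ^ k), inv_pow, hXQ]
  generalize w ^ 2 ^ k = W at *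
  rw [← sub_eq_zero (a := g), ← sub_eq_zero (a := g), ← mul_eq_zero]
  have key : (g - (W * w + (W * w)⁻¹)) * (g - (W * w⁻¹ + (W * w⁻¹)⁻¹)) =
      ((w + w⁻¹) * (W + W⁻¹)) ^ 2 * (g * ((W + W⁻¹)⁻¹ * (w + w⁻¹)⁻¹) +
        (g * ((W + W⁻¹)⁻¹ * (w + w⁻¹)⁻¹)) ^ 2 + (w + w⁻¹)⁻¹ ^ 2 + (W + W⁻¹)⁻¹ ^ 2) := by
    have e : ((w + w⁻¹) * (W + W⁻¹)) ^ 2 * (g * ((W + W⁻¹)⁻¹ * (w + w⁻¹)⁻¹) +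
        (g * ((W + W⁻¹)⁻¹ * (w + w⁻¹)⁻¹)) ^ 2 + (w + w⁻¹)⁻¹ ^ 2 + (W + W⁻¹)⁻¹ ^ 2) =
        g * ((w + w⁻¹) * (W + W⁻¹)) + g ^ 2 + (W + W⁻¹) ^ 2 + (w + w⁻¹) ^ 2 := by
      generalize w + w⁻¹ = X at *
      generalize W + W⁻¹ = Y at *
      field_simp
    rw [e]
    simp only [mul_inv, inv_inv]
    have hw1 : w * w⁻¹ = 1 := mul_inv_cancel₀ hw
    have hW1 : W * W⁻¹ = 1 := mul_inv_cancel₀ hW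
    generalize w⁻¹ = a at *
    generalize W⁻¹ = b at *
    linear_combination (W ^ 2 + b ^ 2) * hw1 + (w ^ 2 + a ^ 2) * hW1 -
      (g * (w + a) * (W + b) + W * b + w * a) * h2
  rw [key, mul_eq_zero, or_iff_right (pow_ne_zero _ (mul_ne_zero hX hXQ0))]
  simp only [inv_pow]

/-- The nonzero solutions `B` of the equation whose reciprocals are the preimages of `g` under
the Dickson polynomials of degrees `2 ^ k + 1` and `2 ^ k - 1`. -/
def dicksonSet (F : Type*) [Field F] (k : ℕ) (g : F) : Set F :=
  {B | B ≠ 0 ∧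
    g * B ^ (2 ^ k + 1) + (g * B ^ (2 ^ k + 1)) ^ 2 + B ^ 2 + (B ^ 2 ^ k) ^ 2 = 0}

/-- Elements `w + w⁻¹` of `F` come from `w` with `w ^ (q - 1) = 1` or `w ^ (q + 1) = 1`. These two
groups meet only in `1`, so a `w` with a power equal to `v ≠ 1` must lie in the same group as `v`.
-/
theorem image_dicksonSet {F K : Type*} [Field F] [Fintype F] [Field K] [IsAlgClosed K]
    [Algebra F K] [CharP K 2] {n : ℕ} (hn : n ≠ 0) (hF : Fintype.card F = 2 ^ n) {ε ε' : ℕ}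
    (hε : ε = 2 ^ n - 1 ∧ ε' = 2 ^ n + 1 ∨ ε = 2 ^ n + 1 ∧ ε' = 2 ^ n - 1) {g : F} {v : K}
    (hv0 : v ≠ 0) (hv1 : v ≠ 1) (hv : v + v⁻¹ = algebraMap F K g) (hvε : v ^ ε = 1) (k : ℕ) :
    algebraMap F K '' dicksonSet F k g = (fun w => (w + w⁻¹)⁻¹) ''
      ({w | w ^ (2 ^ k + 1) = v ∧ w ^ ε = 1} ∪ {w | w ^ (2 ^ k - 1) = v ∧ w ^ ε = 1}) := by
  have hpos : 1 < 2 ^ n := Nat.one_lt_two_pow hn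
  have heven : Even (2 ^ n) := (Nat.even_pow.mpr ⟨even_two, hn⟩)
  have hcop : ε.Coprime ε' := by
    have h : (2 ^ n - 1).Coprime (2 ^ n + 1) := by
      have h1 : 2 ^ n + 1 = (2 ^ n - 1) + 2 := by omega
      rw [h1, Nat.coprime_self_add_right, Nat.coprime_two_right]
      exact Nat.Even.sub_odd hpos.le heven odd_one
    rcases hε with ⟨rfl, rfl⟩ | ⟨rfl, rfl⟩
    exacts [h, h.symm]
  have hε0 : 0 < ε := by omega
  have hfix : ∀ {w : K}, w ≠ 0 →
      ((w + w⁻¹) ^ 2 ^ n = w + w⁻¹ ↔ w ^ ε = 1 ∨ w ^ ε' = 1) := fun {w} hw => by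
    rw [add_inv_pow_card_eq_self_iff hw]
    rcases hε with ⟨rfl, rfl⟩ | ⟨rfl, rfl⟩
    exacts [Iff.rfl, or_comm]
  have hne : ∀ {w : K}, w ≠ 0 → w ≠ 1 → w + w⁻¹ ≠ 0 := by
    intro w hw hw1 h
    rw [add_eq_zero_iff_eq_of_char_two] at h
    refine hw1 (sq_eq_one_iff_of_char_two.mp ?_)
    rw [sq]
    nth_rw 2 [h]
    exact mul_inv_cancel₀ hw
  have hmap : ∀ B : F, B ∈ dicksonSet F k g ↔ algebraMap F K B ≠ 0 ∧
      algebraMap F K g * algebraMap F K B ^ (2 ^ k + 1) +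
      (algebraMap F K g * algebraMap F K B ^ (2 ^ k + 1)) ^ 2 + algebraMap F K B ^ 2 +
      (algebraMap F K B ^ 2 ^ k) ^ 2 = 0 := fun B => by
    simp only [dicksonSet, Set.mem_ofPred_eq, ne_eq, ← map_pow, ← map_mul, ← map_add,
      map_eq_zero]
  ext z
  constructor
  · rintro ⟨B, hB, rfl⟩
    rw [hmap] at hB
    obtain ⟨hB0, hB⟩ := hB
    obtain ⟨w, hw, hwB⟩ := exists_add_inv_eq (algebraMap F K B)⁻¹
    have hB' : algebraMap F K B = (w + w⁻¹)⁻¹ := by rw [hwB, inv_inv]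
    have hX : w + w⁻¹ ≠ 0 := hwB ▸ inv_ne_zero hB0
    rw [hB', dickson_factorization hw hX, ← hv] at hB
    have hwfix := (hfix hw).mp (by rw [hwB, inv_pow, ← map_pow, ← hF, FiniteField.pow_card])
    have hwrong : ∀ {u : K} {e : ℕ}, u ^ e = v → u ^ ε' = 1 → False := by
      rintro u e rfl hu
      refine hv1 ((pow_eq_one_iff_of_coprime hcop).mp ⟨hvε, ?_⟩)
      rw [← pow_mul, mul_comm, pow_mul, hu, one_pow]
    have key : ∀ {e : ℕ}, v + v⁻¹ = w ^ e + (w ^ e)⁻¹ →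
        ∃ u : K, (u ^ e = v ∧ u ^ ε = 1) ∧ (u + u⁻¹)⁻¹ = (w + w⁻¹)⁻¹ := by
      intro e he
      rcases (add_inv_eq_add_inv_iff hv0 (pow_ne_zero _ hw)).mp he with h | h
      · exact ⟨w, ⟨h.symm, hwfix.resolve_right fun h' => hwrong h.symm h'⟩, rfl⟩
      · have h1 : w⁻¹ ^ e = v := by rw [inv_pow, inv_eq_of_mul_eq_one_left h]
        have h2 : w⁻¹ ^ ε = 1 ∨ w⁻¹ ^ ε' = 1 := by simpa only [inv_pow, inv_eq_one] using hwfix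
        exact ⟨w⁻¹, ⟨h1, h2.resolve_right fun h' => hwrong h1 h'⟩, by rw [inv_inv, add_comm]⟩
    rw [hB']
    rcases hB with h | h
    · obtain ⟨u, hu, hu'⟩ := key h
      exact ⟨u, Or.inl hu, hu'⟩
    · obtain ⟨u, hu, hu'⟩ := key h
      exact ⟨u, Or.inr hu, hu'⟩
  · rintro ⟨w, hw, rfl⟩
    have hwε : w ^ ε = 1 := hw.elim And.right And.right
    have hw0 : w ≠ 0 := by
      rintro rfl
      rw [zero_pow hε0.ne'] at hwε
      exact zero_ne_one hwε
    have hw1 : w ≠ 1 := by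
      rintro rfl
      simp only [Set.mem_union, Set.mem_ofPred_eq, one_pow] at hw
      exact hv1 (hw.elim And.left And.left).symm
    have hX := hne hw0 hw1
    obtain ⟨B, hB⟩ := mem_range_algebraMap_of_pow_card (F := F) (z := (w + w⁻¹)⁻¹) (by
      rw [hF, inv_pow, (hfix hw0).mpr (Or.inl hwε)])
    refine ⟨B, ?_, hB⟩
    rw [hmap, hB, dickson_factorization hw0 hX, ← hv]
    refine ⟨inv_ne_zero hX, hw.imp ?_ ?_⟩ <;>
    · rintro ⟨rfl, -⟩
      rfl

/-- A collision would be a pair with `x * y = 1`. Within one of the two sets this gives `v ^ 2 = 1`;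
across them it gives `y ^ (2 * 2 ^ k) = 1`. Both force `v = 1` in characteristic two. -/
theorem injOn_inv_add_inv {K : Type*} [Field K] [CharP K 2] {k ε : ℕ} {v : K} (hε : 0 < ε)
    (hv1 : v ≠ 1) :
    Set.InjOn (fun w : K => (w + w⁻¹)⁻¹)
      ({w | w ^ (2 ^ k + 1) = v ∧ w ^ ε = 1} ∪ {w | w ^ (2 ^ k - 1) = v ∧ w ^ ε = 1}) := by
  have hne : ∀ {w : K}, w ^ ε = 1 → w ≠ 0 := by
    rintro _ h rfl
    rw [zero_pow hε.ne'] at h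
    exact zero_ne_one h
  have hQ : 2 ^ k + 1 + (2 ^ k - 1) = 2 ^ (k + 1) := by
    have := Nat.one_le_two_pow (n := k)
    rw [pow_succ]
    omega
  have hone : ∀ {w : K}, w ^ 2 ^ (k + 1) = 1 → w = 1 := fun {w} h => by
    have h1 : (w + 1) ^ 2 ^ (k + 1) = 0 := by
      rw [add_pow_two_pow_of_char_two, h, one_pow, CharTwo.add_self_eq_zero]
    exact add_eq_zero_iff_eq_of_char_two.mp ((pow_eq_zero_iff (by positivity)).mp h1)
  have hsame : ∀ {x y : K} {e : ℕ}, x ^ e = v → y ^ e = v → x * y ≠ 1 := by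
    intro x y e hx hy h
    have h1 : v * v = 1 := by
      nth_rw 1 [← hx]
      rw [← hy, ← mul_pow, h, one_pow]
    rw [← sq] at h1
    exact hv1 (sq_eq_one_iff_of_char_two.mp h1)
  have hdiff : ∀ {x y : K}, x ^ (2 ^ k + 1) = v → y ^ (2 ^ k - 1) = v → y ≠ 0 → x * y ≠ 1 := by
    intro x y hx hy hy0 h
    rw [eq_inv_of_mul_eq_one_left h, inv_pow, ← hy] at hx
    have h1 : y ^ 2 ^ (k + 1) = 1 := by
      rw [← hQ, pow_add, ← hx, mul_inv_cancel₀ (pow_ne_zero _ hy0)]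
    rw [hone h1, one_pow] at hy
    exact hv1 hy.symm
  intro x hx y hy hxy
  have hx0 := hne (hx.elim And.right And.right)
  have hy0 := hne (hy.elim And.right And.right)
  refine ((add_inv_eq_add_inv_iff hx0 hy0).mp (inv_injective hxy)).resolve_right ?_
  rcases hx with hx | hx <;> rcases hy with hy | hy
  · exact hsame hx.1 hy.1
  · exact hdiff hx.1 hy.1 hy0
  · rw [mul_comm]
    exact hdiff hy.1 hx.1 hx0
  · exact hsame hx.1 hy.1

theorem ncard_dicksonSet_eq_add {F K : Type*} [Field F] [Fintype F] [Field K] [IsAlgClosed K]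
    [Algebra F K] [CharP K 2] {n : ℕ} (hn : n ≠ 0) (hF : Fintype.card F = 2 ^ n) {ε ε' : ℕ}
    (hε : ε = 2 ^ n - 1 ∧ ε' = 2 ^ n + 1 ∨ ε = 2 ^ n + 1 ∧ ε' = 2 ^ n - 1) {g : F} {v : K}
    (hv0 : v ≠ 0) (hv1 : v ≠ 1) (hv : v + v⁻¹ = algebraMap F K g) (hvε : v ^ ε = 1) (k : ℕ) :
    (dicksonSet F k g).ncard = {w : K | w ^ (2 ^ k + 1) = v ∧ w ^ ε = 1}.ncard +
      {w : K | w ^ (2 ^ k - 1) = v ∧ w ^ ε = 1}.ncard := by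
  have hpos : 1 < 2 ^ n := Nat.one_lt_two_pow hn
  have hε0 : 0 < ε := by omega
  rw [← Set.ncard_image_of_injective _ (algebraMap F K).injective,
    image_dicksonSet hn hF hε hv0 hv1 hv hvε k, (injOn_inv_add_inv hε0 hv1).ncard_image]
  refine Set.ncard_union_eq (Set.disjoint_left.mpr ?_)
    (finite_setOf_pow_eq_and_pow_eq_one hε0 v) (finite_setOf_pow_eq_and_pow_eq_one hε0 v)
  rintro w ⟨h1, -⟩ ⟨h2, -⟩
  have hQ : 2 ^ k + 1 = (2 ^ k - 1) + 2 := by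
    have := Nat.one_le_two_pow (n := k)
    omega
  rw [hQ, pow_add, h2, mul_eq_left₀ hv0] at h1
  rw [sq_eq_one_iff_of_char_two.mp h1, one_pow] at h2
  exact hv1 h2.symm

theorem ncard_dicksonSet_eq {F : Type*} [Field F] [Fintype F] [CharP F 2] {n k : ℕ}
    (hn : Odd n) (hF : Fintype.card F = 2 ^ n) (hk : k.Coprime n) (g : F) :
    (dicksonSet F k g).ncard = (dicksonSet F 1 g).ncard := by
  rcases eq_or_ne g 0 with rfl | hg
  -- For `g = 0` the parametrisation degenerates to `v = 1`, so this case is solved directly.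
  · have h : ∀ j : ℕ, j.Coprime n → dicksonSet F j 0 = {1} := fun j hj => by
      ext B
      simp only [dicksonSet, Set.mem_ofPred_eq, zero_mul, ne_eq, two_ne_zero, not_false_eq_true,
        zero_pow, zero_add, Set.mem_singleton_iff]
      constructor
      · rintro ⟨hB0, hB⟩
        rw [← CharTwo.add_sq, pow_eq_zero_iff two_ne_zero, add_eq_zero_iff_eq_of_char_two] at hB
        have h1 : B ^ (2 ^ j - 1) = 1 := by
          refine mul_right_cancel₀ hB0 ?_
          rw [← pow_succ, Nat.sub_add_cancel Nat.one_le_two_pow, ← hB, one_mul]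
        have h2 := FiniteField.pow_card_sub_one_eq_one B hB0
        rw [hF] at h2
        exact (pow_eq_one_iff_of_coprime (two_pow_sub_one_coprime hj)).mp ⟨h1, h2⟩
      · rintro rfl
        exact ⟨one_ne_zero, by simp [CharTwo.add_self_eq_zero]⟩
    rw [h k hk, h 1 (Nat.coprime_one_left n)]
  · have hn0 : n ≠ 0 := hn.pos.ne'
    let K := AlgebraicClosure F
    have : CharP K 2 := charP_of_injective_algebraMap (algebraMap F K).injective 2
    obtain ⟨v, hv0, hv⟩ := exists_add_inv_eq (algebraMap F K g)
    have hv1 : v ≠ 1 := by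
      rintro rfl
      rw [inv_one, CharTwo.add_self_eq_zero, eq_comm, map_eq_zero] at hv
      exact hg hv
    have hpow := (add_inv_pow_card_eq_self_iff hv0 n).mp (by
      rw [hv, ← map_pow, ← hF, FiniteField.pow_card])
    obtain ⟨ε, ε', hε, hvε⟩ : ∃ ε ε' : ℕ,
        (ε = 2 ^ n - 1 ∧ ε' = 2 ^ n + 1 ∨ ε = 2 ^ n + 1 ∧ ε' = 2 ^ n - 1) ∧ v ^ ε = 1 := by
      rcases hpow with h | h
      exacts [⟨_, _, Or.inl ⟨rfl, rfl⟩, h⟩, ⟨_, _, Or.inr ⟨rfl, rfl⟩, h⟩]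
    have hpos : 1 < 2 ^ n := Nat.one_lt_two_pow hn0
    have hε0 : 0 < ε := by omega
    rw [ncard_dicksonSet_eq_add hn0 hF hε hv0 hv1 hv hvε k,
      ncard_dicksonSet_eq_add hn0 hF hε hv0 hv1 hv hvε 1]
    rcases two_pow_gcd_eq_or hn hk (hε.imp And.left And.left) with ⟨h1, h2⟩ | ⟨h1, h2⟩
    · rw [ncard_pow_eq_of_gcd_eq hε0 h1, ncard_pow_eq_of_gcd_eq hε0 h2]
    · rw [ncard_pow_eq_of_gcd_eq hε0 h1, ncard_pow_eq_of_gcd_eq hε0 h2, add_comm]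

/-! ### Dickson sums, cubic sums and the transform of the Kasami function -/

namespace IsTraceSign

variable {F : Type*} [Field F] [CharP F 2] [Fintype F] [DecidableEq F] {χ : AddChar F ℤ}

/-- The sum of `χ (x * (B + B ^ Q))`, `Q = 2 ^ k`, over `(x ^ 2 + x) * B ^ (Q + 1) = m`. -/
def dicksonSum (χ : AddChar F ℤ) (k : ℕ) (m : F) : ℤ :=
  ∑ B : F, ∑ x : F, if B ≠ 0 ∧ (x ^ 2 + x) * B ^ (2 ^ k + 1) = m
    then χ (x * (B + B ^ 2 ^ k)) else 0

/-- Summing over `m` removes the constraint. For fixed `B` the sum over `x` is then quadratic, and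
it is nonzero precisely under the equation defining `dicksonSet`. -/
theorem sum_mul_dicksonSum (hχ : IsTraceSign χ) (k : ℕ) (g : F) :
    ∑ m, χ (g * m) * dicksonSum χ k m = Fintype.card F * (dicksonSet F k g).ncard := by
  classical
  have h1 : ∀ B x : F, ∑ m, χ (g * m) * (if B ≠ 0 ∧ (x ^ 2 + x) * B ^ (2 ^ k + 1) = m
      then χ (x * (B + B ^ 2 ^ k)) else 0) = if B ≠ 0 then
        χ (g * B ^ (2 ^ k + 1) * x ^ 2 + (g * B ^ (2 ^ k + 1) + B + B ^ 2 ^ k) * x) else 0 := by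
    intro B x
    by_cases hB : B = 0
    · simp [hB]
    · simp only [hB, ne_eq, not_false_eq_true, true_and, if_true, mul_ite, mul_zero,
        Finset.sum_ite_eq, Finset.mem_univ]
      rw [← AddChar.map_add_eq_mul]
      congr 1
      ring
  have h2 : ∀ B : F, (∑ x : F, if B ≠ 0 then
        χ (g * B ^ (2 ^ k + 1) * x ^ 2 + (g * B ^ (2 ^ k + 1) + B + B ^ 2 ^ k) * x) else 0) =
      if B ∈ dicksonSet F k g then (Fintype.card F : ℤ) else 0 := by
    intro B
    by_cases hB : B = 0
    · simp [hB, dicksonSet]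
    · have hiff : g * B ^ (2 ^ k + 1) = (g * B ^ (2 ^ k + 1) + B + B ^ 2 ^ k) ^ 2 ↔
          B ∈ dicksonSet F k g := by
        simp only [dicksonSet, Set.mem_ofPred_eq, ne_eq, hB, not_false_eq_true, true_and]
        rw [← add_eq_zero_iff_eq_of_char_two, CharTwo.add_sq, CharTwo.add_sq]
        simp only [add_assoc]
      simp only [hB, ne_eq, not_false_eq_true, if_true, hχ.sum_quadratic, hiff]
  simp only [dicksonSum, Finset.mul_sum]
  rw [Finset.sum_comm]
  simp_rw [Finset.sum_comm (s := Finset.univ (α := F)) (t := Finset.univ (α := F))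
    (f := fun m x => χ (g * m) * _), h1, h2]
  rw [← Finset.sum_filter, Finset.sum_const, nsmul_eq_mul, mul_comm, Set.ncard_eq_toFinset_card']
  congr 3
  ext B
  simp

theorem dicksonSum_eq (hχ : IsTraceSign χ) {n k : ℕ} (hn : Odd n) (hF : Fintype.card F = 2 ^ n)
    (hk : k.Coprime n) (m : F) : dicksonSum χ k m = dicksonSum χ 1 m :=
  hχ.eq_of_sum_mul_eq (fun g => by
    rw [hχ.sum_mul_dicksonSum, hχ.sum_mul_dicksonSum, ncard_dicksonSet_eq hn hF hk]) m

/-- The Walsh transform of the cube function, up to a reparametrisation. -/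
def cubicSum (χ : AddChar F ℤ) (m : F) : ℤ := ∑ z, χ (m * (z ^ 3 + z))

/-- For `k = 1` the constraint makes the summand equal to `χ (m * B⁻¹)`, independent of `x`, and the
number of `x` is an Artin-Schreier count. The `2` is the contribution of `B = 0` on the right, where
`B⁻¹ = 0`. -/
theorem two_add_dicksonSum_one (hχ : IsTraceSign χ) {m : F} (hm : m ≠ 0) :
    2 + dicksonSum χ 1 m = cubicSum χ m := by
  have h1 : ∀ B : F, (∑ x : F, if B ≠ 0 ∧ (x ^ 2 + x) * B ^ (2 ^ 1 + 1) = m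
      then χ (x * (B + B ^ 2 ^ 1)) else 0) + (if B = 0 then 2 else 0) =
      χ (m * B⁻¹) + χ (m * (B⁻¹ ^ 3 + B⁻¹)) := by
    intro B
    by_cases hB : B = 0
    · simp [hB]
    · have h2 : ∀ x : F, (if B ≠ 0 ∧ (x ^ 2 + x) * B ^ (2 ^ 1 + 1) = m
          then χ (x * (B + B ^ 2 ^ 1)) else 0) =
          if x ^ 2 + x = m * B⁻¹ ^ 3 then χ (m * B⁻¹) else 0 := by
        intro x
        have hiff : B ≠ 0 ∧ (x ^ 2 + x) * B ^ (2 ^ 1 + 1) = m ↔ x ^ 2 + x = m * B⁻¹ ^ 3 := by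
          rw [inv_pow, eq_mul_inv_iff_mul_eq₀ (pow_ne_zero _ hB)]
          exact and_iff_right hB
        refine if_ctx_congr hiff (fun hx => ?_) fun _ => rfl
        have e : m * B⁻¹ = (x * B) ^ 2 + x * B ^ 2 ^ 1 := by
          rw [← ((hiff.mpr hx).2)]
          field_simp
          ring
        rw [e, AddChar.map_add_eq_mul, hχ.map_sq, ← AddChar.map_add_eq_mul, mul_add]
      rw [Fintype.sum_congr _ _ h2, ← Finset.sum_filter, Finset.sum_const, nsmul_eq_mul,
        hχ.card_sq_add_self_eq, if_neg hB, mul_add m, AddChar.map_add_eq_mul]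
      ring
  have h3 : ∑ B : F, (χ (m * B⁻¹) + χ (m * (B⁻¹ ^ 3 + B⁻¹))) =
      ∑ z, (χ (m * z) + χ (m * (z ^ 3 + z))) :=
    inv_involutive.bijective.sum_comp fun z => χ (m * z) + χ (m * (z ^ 3 + z))
  have h4 : ∑ z, χ (m * z) = 0 := by
    simp only [mul_comm m, hχ.sum_mul, if_neg hm]
  have h5 : ∑ z, (χ (m * z) + χ (m * (z ^ 3 + z))) = cubicSum χ m := by
    rw [Finset.sum_add_distrib, h4, zero_add]
    rfl
  rw [h5, ← Fintype.sum_congr _ _ h1, Finset.sum_add_distrib, Finset.sum_ite_eq' Finset.univ,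
    if_pos (Finset.mem_univ _)] at h3
  rw [← h3, dicksonSum, add_comm]

omit [DecidableEq F] in
theorem cubicSum_pow_two_pow (hχ : IsTraceSign χ) (k : ℕ) (m : F) :
    cubicSum χ (m ^ 2 ^ k) = cubicSum χ m := by
  have hsq : ∀ m : F, cubicSum χ (m ^ 2) = cubicSum χ m := fun m => by
    rw [cubicSum, ← sq_bijective_of_char_two.sum_comp]
    refine Fintype.sum_congr _ _ fun z => ?_
    rw [← hχ.map_sq (m * _), mul_pow, CharTwo.add_sq]
    congr 3
    ring
  induction k with
  | zero => rw [pow_zero, pow_one]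
  | succ k ih => rw [pow_succ, pow_mul, hsq, ih]

omit [DecidableEq F] in
-- Rescaling `z` in the sum for a square root of `m`, which has the same value, puts all dependence
-- on `m` into the cubic coefficient. This makes products of such sums tractable.
theorem cubicSum_eq_sum_inv (hχ : IsTraceSign χ) {m : F} (hm : m ≠ 0) :
    cubicSum χ m = ∑ z, χ (z ^ 3 * m⁻¹ + z) := by
  obtain ⟨r, rfl⟩ := sq_bijective_of_char_two.surjective m
  have hr : r ≠ 0 := by
    rintro rfl
    simp at hm
  have h : cubicSum χ (r ^ 2) = cubicSum χ r := hχ.cubicSum_pow_two_pow 1 r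
  change cubicSum χ (r ^ 2) = ∑ z, χ (z ^ 3 * (r ^ 2)⁻¹ + z)
  rw [h, cubicSum, ← Equiv.sum_comp (Equiv.mulLeft₀ r⁻¹ (inv_ne_zero hr))]
  refine Fintype.sum_congr _ _ fun z => ?_
  congr 1
  simp only [Equiv.mulLeft₀_apply]
  field_simp

/-- After the shift `z + a`, the sum over `z` is quadratic and vanishes unless `a = a ^ 4`, that is,
unless `a` is `0` or `1`. The sign of `χ r` comes from `χ 1 = -1`. -/
theorem cubicSum_cube_sq (hχ : IsTraceSign χ) (h3 : Nat.Coprime 3 (Fintype.card F - 1)) {r : F}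
    (hr : r ≠ 0) : cubicSum χ (r ^ 3) ^ 2 = Fintype.card F * (1 - χ r) := by
  have h1 : cubicSum χ (r ^ 3) = ∑ z, χ (z ^ 3 + r ^ 2 * z) := by
    rw [cubicSum, ← Equiv.sum_comp (Equiv.mulLeft₀ r⁻¹ (inv_ne_zero hr))]
    refine Fintype.sum_congr _ _ fun z => ?_
    congr 1
    simp only [Equiv.mulLeft₀_apply]
    field_simp
  have h2 : ∀ z, χ (z ^ 3 + r ^ 2 * z) * ∑ a, χ (a ^ 3 + r ^ 2 * a) =
      ∑ a, χ (a ^ 3 + r ^ 2 * a) * χ (a * z ^ 2 + a ^ 2 * z) := fun z => by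
    rw [← Equiv.sum_comp (Equiv.addLeft z), Finset.mul_sum]
    refine Fintype.sum_congr _ _ fun a => ?_
    rw [← AddChar.map_add_eq_mul, ← AddChar.map_add_eq_mul, Equiv.coe_addLeft]
    congr 1
    linear_combination (z ^ 3 + r ^ 2 * z + z ^ 2 * a + z * a ^ 2) *
      (CharTwo.two_eq_zero : (2 : F) = 0)
  have h4 : (Finset.univ.filter fun a : F => a = (a ^ 2) ^ 2) = {0, 1} := by
    ext a
    simp only [Finset.mem_filter_univ, Finset.mem_insert, Finset.mem_singleton]
    constructor
    · intro ha
      by_cases ha0 : a = 0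
      · exact Or.inl ha0
      · refine Or.inr ((pow_bijective_of_coprime three_ne_zero h3).injective ?_)
        refine mul_left_cancel₀ ha0 ?_
        linear_combination -ha
    · rintro (rfl | rfl) <;> ring
  rw [sq, h1, Finset.sum_mul, Fintype.sum_congr _ _ h2, Finset.sum_comm]
  simp only [← Finset.mul_sum, hχ.sum_quadratic, mul_ite, mul_zero]
  rw [← Finset.sum_filter, h4, Finset.sum_pair zero_ne_one]
  simp only [ne_eq, OfNat.ofNat_ne_zero, not_false_eq_true, zero_pow, mul_zero, add_zero,
    AddChar.map_zero_eq_one, one_pow, mul_one, AddChar.map_add_eq_mul, hχ.map_one, hχ.map_sq]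
  ring

/-- The Walsh transform of a function `φ` which satisfies the equation of the Kasami block. -/
theorem sum_mul_eq_cubicSum (hχ : IsTraceSign χ) {n k : ℕ} (hn : Odd n)
    (hF : Fintype.card F = 2 ^ n) (hk : k.Coprime n) {φ : F → F} (h0 : φ 0 = 0) (h1 : φ 1 = 0)
    (hφ : ∀ x, φ x ^ (2 ^ k + 1) * (x ^ 2 + x) ^ 2 ^ k = (x ^ 2 ^ k + x) ^ (2 ^ k + 1)) {y : F}
    (hy : y ≠ 0) : ∑ x, χ (y * φ x) = cubicSum χ (y ^ (2 ^ k + 1)) := by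
  have hbij := pow_bijective_of_coprime (F := F) (Nat.succ_ne_zero (2 ^ k))
    (hF ▸ coprime_two_pow_add_one hn hk)
  obtain ⟨Y, rfl⟩ : ∃ Y : F, Y ^ 2 ^ k = y := by
    refine (Finite.surjective_of_injective (f := fun Y : F => Y ^ 2 ^ k) fun a b hab => ?_) y
    have h : (a + b) ^ 2 ^ k = 0 := by
      rw [add_pow_two_pow_of_char_two, add_eq_zero_iff_eq_of_char_two]
      exact hab
    exact add_eq_zero_iff_eq_of_char_two.mp ((pow_eq_zero_iff (by positivity)).mp h)
  have hY : Y ≠ 0 := by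
    rintro rfl
    exact hy (zero_pow (by positivity))
  have hm : Y ^ (2 ^ k + 1) ≠ 0 := pow_ne_zero _ hY
  have key : ∀ x, χ (Y ^ 2 ^ k * φ x) = (if x ^ 2 + x = 0 then 1 else 0) +
      ∑ B : F, if B ≠ 0 ∧ (x ^ 2 + x) * B ^ (2 ^ k + 1) = Y ^ (2 ^ k + 1)
        then χ (x * (B + B ^ 2 ^ k)) else 0 := by
    intro x
    by_cases hx : x ^ 2 + x = 0
    · have hφx : φ x = 0 := by
        have : x * (x + 1) = 0 := by linear_combination hx
        rcases mul_eq_zero.mp this with rfl | h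
        · exact h0
        · rw [add_eq_zero_iff_eq_of_char_two.mp h, h1]
      simp [hx, hφx, hm.symm]
    · obtain ⟨b, hb⟩ := hbij.surjective (Y ^ (2 ^ k + 1) / (x ^ 2 + x))
      have hb : b ^ (2 ^ k + 1) = Y ^ (2 ^ k + 1) / (x ^ 2 + x) := hb
      have hiff : ∀ B : F, B ≠ 0 ∧ (x ^ 2 + x) * B ^ (2 ^ k + 1) = Y ^ (2 ^ k + 1) ↔ B = b := by
        intro B
        constructor
        · rintro ⟨-, hB⟩
          refine hbij.injective ?_
          change B ^ (2 ^ k + 1) = b ^ (2 ^ k + 1)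
          rw [hb, eq_div_iff hx, mul_comm, hB]
        · rintro rfl
          refine ⟨?_, by rw [hb, mul_div_cancel₀ _ hx]⟩
          rintro rfl
          rw [zero_pow (Nat.succ_ne_zero _)] at hb
          exact div_ne_zero hm hx hb.symm
      simp only [hiff, if_neg hx, zero_add, Finset.sum_ite_eq', Finset.mem_univ, if_true]
      have e : Y ^ 2 ^ k * φ x = (b * x) ^ 2 ^ k + b ^ 2 ^ k * x := by
        refine hbij.injective ?_
        change (Y ^ 2 ^ k * φ x) ^ (2 ^ k + 1) = ((b * x) ^ 2 ^ k + b ^ 2 ^ k * x) ^ (2 ^ k + 1)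
        refine mul_right_cancel₀ (pow_ne_zero (2 ^ k) hx) ?_
        rw [mul_pow, mul_assoc, hφ, mul_pow, ← mul_add, mul_pow, ← pow_mul, ← pow_mul,
          mul_comm (2 ^ k), pow_mul, pow_mul, hb, div_pow, mul_right_comm,
          div_mul_cancel₀ _ (pow_ne_zero _ hx)]
      rw [e, AddChar.map_add_eq_mul, hχ.map_pow_two_pow, ← AddChar.map_add_eq_mul]
      congr 1
      ring
  have hcard : (∑ x : F, if x ^ 2 + x = 0 then (1 : ℤ) else 0) = 2 := by
    rw [← Finset.sum_filter, Finset.sum_const, nsmul_one, hχ.card_sq_add_self_eq,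
      AddChar.map_zero_eq_one]
    rfl
  rw [Fintype.sum_congr _ _ key, Finset.sum_add_distrib, hcard, Finset.sum_comm,
    ← pow_mul, mul_comm (2 ^ k), pow_mul, hχ.cubicSum_pow_two_pow,
    ← hχ.two_add_dicksonSum_one hm, ← hχ.dicksonSum_eq hn hF hk]
  rfl

end IsTraceSign

/-! ### The Walsh transform of the Kasami block -/

theorem pow_invExponent_pow {F : Type*} [Field F] [Fintype F] {n k : ℕ} (hn : Odd n) (hn1 : 1 < n)
    (hF : Fintype.card F = 2 ^ n) (hk : k.Coprime n) (w : F) :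
    (w ^ invExponent (2 ^ n) (2 ^ k + 1)) ^ (2 ^ k + 1) = w := by
  have hq : 4 ≤ 2 ^ n := Nat.pow_le_pow_right two_pos hn1
  have hmod := mul_invExponent_modEq (q := 2 ^ n) (by omega) (coprime_two_pow_add_one hn hk)
  rw [← pow_mul, mul_comm]
  rcases eq_or_ne w 0 with rfl | hw
  -- A zero exponent would give `0 ≡ 1` modulo `q - 1 ≥ 3`.
  · refine zero_pow fun h => ?_
    rw [h, Nat.ModEq, Nat.zero_mod, Nat.mod_eq_of_lt (by omega)] at hmod
    exact zero_ne_one hmod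
  · have h1 := FiniteField.pow_card_sub_one_eq_one w hw
    rw [hF] at h1
    rw [pow_eq_pow_of_modEq hmod h1, pow_one]

/-- A bijective version of `y ↦ y ^ ((2 ^ k + 1) / 3)`. -/
theorem exists_cube_eq_pow {F : Type*} [Field F] [Fintype F] {n k : ℕ} (hn : Odd n)
    (hF : Fintype.card F = 2 ^ n) (hk : k.Coprime n) :
    ∃ ρ : F → F, Function.Bijective ρ ∧ (∀ y, ρ y ^ 3 = y ^ (2 ^ k + 1)) := by
  have h3 : Nat.Coprime 3 (Fintype.card F - 1) :=
    hF ▸ coprime_two_pow_add_one (i := 1) hn (Nat.coprime_one_left n)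
  have hbij := pow_bijective_of_coprime (F := F) (Nat.succ_ne_zero (2 ^ k))
    (hF ▸ coprime_two_pow_add_one hn hk)
  let e := Equiv.ofBijective _ (pow_bijective_of_coprime (F := F) three_ne_zero h3)
  exact ⟨fun y => e.symm (y ^ (2 ^ k + 1)), e.symm.bijective.comp hbij,
    fun y => e.apply_symm_apply (y ^ (2 ^ k + 1))⟩

open Classical in
/-- The sign function which is `-1` on the Kasami block. -/
noncomputable def blockSign (F : Type*) [Field F] (n k : ℕ) (w : F) : ℤ :=
  if w ∈ kasamiBlock F n k then -1 else 1

section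

variable {F : Type*} [Field F]

/-- The function whose range is the complement of the Kasami block. -/
def kasamiFun (n k : ℕ) (x : F) : F :=
  ((x + 1) ^ kasamiExponent k + x ^ kasamiExponent k + 1) ^ invExponent (2 ^ n) (2 ^ k + 1)

theorem pow_kasamiExponent_mul (k : ℕ) (x : F) :
    x ^ kasamiExponent k * x ^ 2 ^ k = (x ^ 2 ^ k) ^ 2 ^ k * x := by
  have h : 2 ^ k ≤ 2 ^ (2 * k) := Nat.pow_le_pow_right two_pos (by omega)
  rw [← pow_mul, ← pow_add 2, ← two_mul, ← pow_add, ← pow_succ, kasamiExponent]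
  congr 1
  omega

variable [CharP F 2]

theorem kasamiFun_add_one (n k : ℕ) (x : F) : kasamiFun n k (x + 1) = kasamiFun n k x := by
  rw [kasamiFun, kasamiFun, add_assoc x, CharTwo.add_self_eq_zero, add_zero, add_comm (x ^ _)]

variable [Fintype F] {n k : ℕ}

theorem kasamiFun_pow (hn : Odd n) (hn1 : 1 < n) (hF : Fintype.card F = 2 ^ n)
    (hk : k.Coprime n) (x : F) : kasamiFun n k x ^ (2 ^ k + 1) * (x ^ 2 + x) ^ 2 ^ k =
      (x ^ 2 ^ k + x) ^ (2 ^ k + 1) := by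
  have h0 := pow_kasamiExponent_mul k x
  have h1 := pow_kasamiExponent_mul k (x + 1)
  have h2 : (2 : F) = 0 := CharTwo.two_eq_zero
  have hx : x ^ 2 + x = x * (x + 1) := by ring
  rw [kasamiFun, pow_invExponent_pow hn hn1 hF hk, hx, mul_pow, pow_succ]
  simp only [add_pow_two_pow_of_char_two, one_pow] at h1 ⊢
  generalize x ^ kasamiExponent k = a at *
  generalize (x + 1) ^ kasamiExponent k = b at *
  generalize x ^ 2 ^ k = X at *
  generalize X ^ 2 ^ k = Z at *
  linear_combination (X + 1) * h0 + X * h1 + (X * Z * x + X) * h2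

theorem kasamiFun_zero (hn : Odd n) (hn1 : 1 < n) (hF : Fintype.card F = 2 ^ n)
    (hk : k.Coprime n) : kasamiFun n k (0 : F) = 0 := by
  have h := pow_invExponent_pow hn hn1 hF hk (0 : F)
  have hs : kasamiExponent k ≠ 0 := Nat.succ_ne_zero _
  rw [kasamiFun, zero_add, one_pow, zero_pow hs, add_zero, CharTwo.add_self_eq_zero]
  exact (pow_eq_zero_iff (Nat.succ_ne_zero _)).mp h

end

namespace IsTraceSign

variable {F : Type*} [Field F] [CharP F 2] [Fintype F] [DecidableEq F] {χ : AddChar F ℤ} {n k : ℕ}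

theorem sum_mul_kasamiFun (hχ : IsTraceSign χ) (hn : Odd n) (hn1 : 1 < n)
    (hF : Fintype.card F = 2 ^ n) (hk : k.Coprime n) {y : F} (hy : y ≠ 0) :
    ∑ x, χ (y * kasamiFun n k x) = cubicSum χ (y ^ (2 ^ k + 1)) :=
  hχ.sum_mul_eq_cubicSum hn hF hk (kasamiFun_zero hn hn1 hF hk)
    (by simpa using (kasamiFun_add_one n k (0 : F)).trans (kasamiFun_zero hn hn1 hF hk))
    (kasamiFun_pow hn hn1 hF hk) hy

theorem cubicSum_pow_sq (hχ : IsTraceSign χ) (hn : Odd n) (hF : Fintype.card F = 2 ^ n) {r m : F}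
    (h : r ^ 3 = m) (hm : m ≠ 0) : cubicSum χ m ^ 2 = 2 ^ n * (1 - χ r) := by
  have h3 : Nat.Coprime 3 (Fintype.card F - 1) :=
    hF ▸ coprime_two_pow_add_one (i := 1) hn (Nat.coprime_one_left n)
  subst h
  rw [hχ.cubicSum_cube_sq h3 (by rintro rfl; simp at hm), hF]
  norm_num

/-- The function `x ↦ (x + 1) ^ s + x ^ s + 1` is two-to-one. -/
theorem card_kasamiFun_fiber (hχ : IsTraceSign χ) (hn : Odd n) (hn1 : 1 < n)
    (hF : Fintype.card F = 2 ^ n) (hk : k.Coprime n) (w : F) :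
    ((Finset.univ.filter fun x : F => kasamiFun n k x = w).card : ℤ) =
      1 + blockSign F n k w := by
  classical
  obtain ⟨ρ, hρ, hρ3⟩ := exists_cube_eq_pow hn hF hk
  have hq : (0 : ℤ) < 2 ^ n := by positivity
  let N : F → ℤ := fun w => ((Finset.univ.filter fun x : F => kasamiFun n k x = w).card : ℤ)
  have hN : ∀ h : F → ℤ, ∑ w, N w * h w = ∑ x, h (kasamiFun n k x) := fun h => by
    rw [← Finset.sum_fiberwise Finset.univ (kasamiFun n k) fun x => h (kasamiFun n k x)]
    refine Fintype.sum_congr _ _ fun w => ?_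
    rw [Finset.sum_congr rfl fun x hx => congrArg h (Finset.mem_filter.mp hx).2, Finset.sum_const,
      nsmul_eq_mul]
  -- Parseval, with the squared transform known at every `y`. At `y = 0` the formula gives `0` where
  -- the true value is `q ^ 2`, hence the correction term.
  have hNsq : ∑ w, N w * N w = 2 * 2 ^ n := by
    have hp : ∀ y, (∑ x, χ (y * kasamiFun n k x)) ^ 2 =
        2 ^ n * (1 - χ (ρ y)) + if y = 0 then (2 ^ n) ^ 2 else 0 := by
      intro y
      rcases eq_or_ne y 0 with rfl | hy
      · have hρ0 : ρ 0 = 0 := by simpa using hρ3 0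
        simp [hρ0, hF]
      · rw [hχ.sum_mul_kasamiFun hn hn1 hF hk hy,
          hχ.cubicSum_pow_sq hn hF (hρ3 y) (pow_ne_zero _ hy), if_neg hy, add_zero]
    have hl : ∑ y, (∑ x, χ (y * kasamiFun n k x)) ^ 2 = 2 ^ n * ∑ w, N w * N w := by
      simp only [sq, Finset.sum_mul_sum, ← AddChar.map_add_eq_mul, ← mul_add]
      rw [Finset.sum_comm, hN, Finset.mul_sum]
      refine Fintype.sum_congr _ _ fun x => ?_
      rw [Finset.sum_comm]
      simp only [hχ.sum_mul, add_eq_zero_iff_eq_of_char_two, ← Finset.sum_filter,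
        Finset.sum_const, nsmul_eq_mul, N, hF, eq_comm (a := kasamiFun n k x)]
      push_cast
      ring
    have hr : ∑ y, (2 ^ n * (1 - χ (ρ y)) + if y = 0 then ((2 : ℤ) ^ n) ^ 2 else 0) =
        2 * (2 ^ n) ^ 2 := by
      rw [Finset.sum_add_distrib, ← Finset.mul_sum, Finset.sum_sub_distrib,
        hρ.sum_comp fun r => χ r, hχ.sum_eq_zero, Finset.sum_ite_eq' Finset.univ,
        if_pos (Finset.mem_univ _)]
      simp [hF]
      ring
    refine mul_left_cancel₀ hq.ne' ?_
    rw [← hl, Fintype.sum_congr _ _ hp, hr]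
    ring
  have hNone : ∑ w, N w = 2 ^ n := by simpa [hF] using hN fun _ => 1
  have hN2 : ∀ w, N w = 0 ∨ 2 ≤ N w := by
    intro w
    rcases Finset.eq_empty_or_nonempty (Finset.univ.filter fun x : F => kasamiFun n k x = w)
      with h | ⟨x, hx⟩
    · left
      simp only [N, h, Finset.card_empty, Nat.cast_zero]
    · right
      have hx' : x + 1 ∈ Finset.univ.filter fun x : F => kasamiFun n k x = w := by
        rw [Finset.mem_filter_univ, kasamiFun_add_one]
        exact (Finset.mem_filter.mp hx).2
      have := Finset.one_lt_card.mpr ⟨x, hx, x + 1, hx', by simp⟩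
      simp only [N]
      exact_mod_cast this
  -- Fibres are stable under `x ↦ x + 1`, so none has size `1`. The nonnegative terms `N w * (N w -
  -- 2)` sum to `2q - 2q = 0`, so every fibre has size `0` or `2`.
  have hnonneg : ∀ w ∈ Finset.univ, 0 ≤ N w * (N w - 2) := by
    intro w _
    rcases hN2 w with h | h
    · rw [h, zero_mul]
    · exact mul_nonneg (by omega) (by omega)
  have hsum : ∑ w, N w * (N w - 2) = 0 := by
    simp only [mul_sub, Finset.sum_sub_distrib, hNsq, ← Finset.sum_mul, hNone]
    ring
  have hw := (Finset.sum_eq_zero_iff_of_nonneg hnonneg).mp hsum w (Finset.mem_univ w)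
  change N w = 1 + blockSign F n k w
  rw [blockSign]
  split_ifs with hB
  · rw [add_neg_cancel]
    simp only [N, Nat.cast_eq_zero, Finset.card_eq_zero, Finset.filter_eq_empty_iff]
    exact fun x _ hx => hB ⟨x, hx⟩
  · rcases mul_eq_zero.mp hw with h | h
    · exfalso
      obtain ⟨x, hx⟩ := not_not.mp hB
      simp only [N, Nat.cast_eq_zero, Finset.card_eq_zero, Finset.filter_eq_empty_iff] at h
      exact h (Finset.mem_univ x) hx
    · omega

/-- **The theorem of Dillon and Dobbertin** on the Walsh transform of the Kasami block. -/
theorem sum_blockSign_mul (hχ : IsTraceSign χ) (hn : Odd n) (hn1 : 1 < n)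
    (hF : Fintype.card F = 2 ^ n) (hk : k.Coprime n) (y : F) :
    ∑ w, blockSign F n k w * χ (y * w) =
      if y = 0 then 0 else cubicSum χ (y ^ (2 ^ k + 1)) := by
  classical
  have h1 : ∀ w, blockSign F n k w * χ (y * w) =
      (∑ x, if kasamiFun n k x = w then χ (y * w) else 0) - χ (w * y) := fun w => by
    rw [← Finset.sum_filter, Finset.sum_const, nsmul_eq_mul,
      hχ.card_kasamiFun_fiber hn hn1 hF hk, mul_comm w]
    ring
  rw [Fintype.sum_congr _ _ h1, Finset.sum_sub_distrib, hχ.sum_mul, Finset.sum_comm]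
  simp only [Finset.sum_ite_eq, Finset.mem_univ, if_true]
  split_ifs with hy
  · simp [hy]
  · rw [hχ.sum_mul_kasamiFun hn hn1 hF hk hy, sub_zero]

end IsTraceSign

/-! ### The diagonal cubic curve attached to three collinear points -/

theorem card_linear_eq {F : Type*} [Field F] [Fintype F] [DecidableEq F] {a b : F}
    (h : a ≠ 0 ∨ b ≠ 0) :
    (∑ x : F, ∑ y : F, if a * x = b * y then (1 : ℤ) else 0) = Fintype.card F := by
  wlog hb : b ≠ 0 generalizing a b
  · rw [Finset.sum_comm]
    simp only [eq_comm (a := a * _)]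
    exact this h.symm (h.resolve_right hb)
  · have h1 : ∀ x y : F, a * x = b * y ↔ b⁻¹ * (a * x) = y := fun x y =>
      ⟨fun h => by rw [h, inv_mul_cancel_left₀ hb], fun h => by rw [← h, mul_inv_cancel_left₀ hb]⟩
    simp [h1]

section Cubic

variable {F : Type*} [Field F] [CharP F 2]

theorem diagonal_cubic_eq {c₁ c₂ C₁ C₂ : F} (h₁ : c₁ ≠ 0) (h₂ : c₂ ≠ 0) (h₃ : c₁ + c₂ ≠ 0)
    (H₁ : C₁ ≠ 0) (H₂ : C₂ ≠ 0) (H₃ : C₁ + C₂ ≠ 0) (hd : c₁ * C₂ + c₂ * C₁ ≠ 0) (x y : F) :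
    x ^ 3 * (C₁ * c₁)⁻¹ + y ^ 3 * (C₂ * c₂)⁻¹ +
        (x + y) ^ 3 * ((C₁ + C₂) * (c₁ + c₂))⁻¹ =
      ((c₁ * y + c₂ * x) ^ 3 * (c₁ * c₂ * (c₁ + c₂))⁻¹ +
        (C₁ * y + C₂ * x) ^ 3 * (C₁ * C₂ * (C₁ + C₂))⁻¹) * (c₁ * C₂ + c₂ * C₁)⁻¹ := by
  have h2 : (2 : F) = 0 := CharTwo.two_eq_zero
  generalize hD : c₁ * C₂ + c₂ * C₁ = D at *
  field_simp
  rw [← hD]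
  linear_combination (c₁ * c₂ * C₁ * C₂ * (x ^ 3 * (c₂ * C₁ + c₁ * C₂ + c₂ * C₂) +
    y ^ 3 * (c₂ * C₁ + c₁ * C₂ + c₁ * C₁) - 3 * x ^ 2 * y * c₂ * C₂ - 3 * x * y ^ 2 * c₁ * C₁)) * h2

variable [Fintype F] [DecidableEq F]

/-- By `diagonal_cubic_eq` the equation says that two cubes agree. Extracting cube roots leaves one
linear equation, nontrivial because `c₁ * C₂ + c₂ * C₁ ≠ 0`. -/
theorem card_diagonal_cubic_line (h3 : Nat.Coprime 3 (Fintype.card F - 1)) {c₁ c₂ C₁ C₂ : F}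
    (h₁ : c₁ ≠ 0) (h₂ : c₂ ≠ 0) (h₃ : c₁ + c₂ ≠ 0)
    (H₁ : C₁ ≠ 0) (H₂ : C₂ ≠ 0) (H₃ : C₁ + C₂ ≠ 0) (hd : c₁ * C₂ + c₂ * C₁ ≠ 0) :
    (∑ x : F, ∑ y : F, if x ^ 3 * (C₁ * c₁)⁻¹ + y ^ 3 * (C₂ * c₂)⁻¹ +
        (x + y) ^ 3 * ((C₁ + C₂) * (c₁ + c₂))⁻¹ = 0 then (1 : ℤ) else 0) = Fintype.card F := by
  have hbij := pow_bijective_of_coprime (F := F) three_ne_zero h3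
  obtain ⟨l, hl⟩ := hbij.surjective (c₁ * c₂ * (c₁ + c₂))⁻¹
  obtain ⟨m, hm⟩ := hbij.surjective (C₁ * C₂ * (C₁ + C₂))⁻¹
  have hl : l ^ 3 = (c₁ * c₂ * (c₁ + c₂))⁻¹ := hl
  have hm : m ^ 3 = (C₁ * C₂ * (C₁ + C₂))⁻¹ := hm
  have hl0 : l ≠ 0 := by
    rintro rfl
    rw [zero_pow three_ne_zero, eq_comm, inv_eq_zero] at hl
    exact mul_ne_zero (mul_ne_zero h₁ h₂) h₃ hl
  have hiff : ∀ x y : F, x ^ 3 * (C₁ * c₁)⁻¹ + y ^ 3 * (C₂ * c₂)⁻¹ +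
        (x + y) ^ 3 * ((C₁ + C₂) * (c₁ + c₂))⁻¹ = 0 ↔
      (c₂ * l + C₂ * m) * x = (c₁ * l + C₁ * m) * y := by
    intro x y
    rw [diagonal_cubic_eq h₁ h₂ h₃ H₁ H₂ H₃ hd, mul_eq_zero, or_iff_left (inv_ne_zero hd), ← hl,
      ← hm, ← mul_pow, ← mul_pow, add_eq_zero_iff_eq_of_char_two]
    rw [show ((c₁ * y + c₂ * x) * l) ^ 3 = ((C₁ * y + C₂ * x) * m) ^ 3 ↔
      (c₁ * y + c₂ * x) * l = (C₁ * y + C₂ * x) * m from hbij.injective.eq_iff]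
    have h2 : (2 : F) = 0 := CharTwo.two_eq_zero
    constructor
    · intro h
      linear_combination h + (C₂ * m * x - c₁ * l * y) * h2
    · intro h
      linear_combination h - (C₂ * m * x - c₁ * l * y) * h2
  simp only [hiff]
  refine card_linear_eq ?_
  by_contra! h
  apply hd
  refine (mul_eq_zero.mp (?_ : l * (c₁ * C₂ + c₂ * C₁) = 0)).resolve_left hl0
  linear_combination C₁ * h.1 + C₂ * h.2 - C₁ * C₂ * m * (CharTwo.two_eq_zero : (2 : F) = 0)

end Cubic

namespace IsTraceSign

variable {F : Type*} [Field F] [CharP F 2] [Fintype F] [DecidableEq F] {χ : AddChar F ℤ} {n k : ℕ}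

/-- Let `T t` be the sum with `χ (t * (x + y + z))`. Homogeneity gives `T t = S` for `t ≠ 0`; `T 0 =
q ^ 2` counts the points of the cone; and `∑ t, T t` is `q` times the number of points with `x + y =
z`, again `q ^ 2`. Hence `(q - 1) * S = 0`. -/
theorem sum_diagonal_cubic (hχ : IsTraceSign χ) (h3 : Nat.Coprime 3 (Fintype.card F - 1))
    {a₁ a₂ a₃ : F} (ha₃ : a₃ ≠ 0)
    (h : (∑ x : F, ∑ y : F, if x ^ 3 * a₁ + y ^ 3 * a₂ + (x + y) ^ 3 * a₃ = 0
      then (1 : ℤ) else 0) = Fintype.card F) :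
    (∑ x : F, ∑ y : F, ∑ z : F, if x ^ 3 * a₁ + y ^ 3 * a₂ + z ^ 3 * a₃ = 0
      then χ (x + y + z) else 0) = 0 := by
  have hbij := pow_bijective_of_coprime (F := F) three_ne_zero h3
  set q : ℤ := (Fintype.card F : ℤ) with hq
  have hq1 : 1 < q := by
    rw [hq]
    exact_mod_cast Fintype.one_lt_card (α := F)
  set S := ∑ x : F, ∑ y : F, ∑ z : F, if x ^ 3 * a₁ + y ^ 3 * a₂ + z ^ 3 * a₃ = 0
      then χ (x + y + z) else 0 with hS
  let T : F → ℤ := fun t => ∑ x : F, ∑ y : F, ∑ z : F,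
    if x ^ 3 * a₁ + y ^ 3 * a₂ + z ^ 3 * a₃ = 0 then χ (t * (x + y + z)) else 0
  have hT : ∀ t, t ≠ 0 → T t = S := by
    intro t ht
    have e := fun f : F → ℤ => Equiv.sum_comp (Equiv.mulLeft₀ t ht) f
    simp only [T, hS]
    refine Eq.trans (Fintype.sum_congr _ _ fun x => ?_) (e _)
    refine Eq.trans (Fintype.sum_congr _ _ fun y => ?_) (e _)
    refine Eq.trans (Fintype.sum_congr _ _ fun z => ?_) (e _)
    simp only [Equiv.mulLeft₀_apply]
    have h1 : (t * x) ^ 3 * a₁ + (t * y) ^ 3 * a₂ + (t * z) ^ 3 * a₃ =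
        t ^ 3 * (x ^ 3 * a₁ + y ^ 3 * a₂ + z ^ 3 * a₃) := by ring
    have h2 : t * x + t * y + t * z = t * (x + y + z) := by ring
    simp only [h1, h2, mul_eq_zero (M₀ := F), pow_eq_zero_iff three_ne_zero, ht, false_or]
  have hT0 : T 0 = q ^ 2 := by
    have h1 : ∀ x y : F, (∑ z : F, if x ^ 3 * a₁ + y ^ 3 * a₂ + z ^ 3 * a₃ = 0
        then χ (0 * (x + y + z)) else 0) = 1 := by
      intro x y
      obtain ⟨u, hu⟩ := hbij.surjective ((x ^ 3 * a₁ + y ^ 3 * a₂) * a₃⁻¹)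
      have hu : u ^ 3 = (x ^ 3 * a₁ + y ^ 3 * a₂) * a₃⁻¹ := hu
      have h2 : ∀ z, x ^ 3 * a₁ + y ^ 3 * a₂ + z ^ 3 * a₃ = 0 ↔ u = z := by
        intro z
        rw [add_eq_zero_iff_eq_of_char_two, ← mul_inv_eq_iff_eq_mul₀ ha₃, ← hu]
        exact hbij.injective.eq_iff
      simp only [h2, zero_mul, AddChar.map_zero_eq_one, Finset.sum_ite_eq, Finset.mem_univ,
        if_true]
    simp only [T, h1]
    simp [hq, sq]
  have hsum : ∑ t, T t = q * q := by
    have h1 : ∑ t, T t = ∑ x : F, ∑ y : F, ∑ z : F, ∑ t : F,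
        if x ^ 3 * a₁ + y ^ 3 * a₂ + z ^ 3 * a₃ = 0 then χ (t * (x + y + z)) else 0 := by
      simp only [T]
      rw [Finset.sum_comm]
      refine Fintype.sum_congr _ _ fun x => ?_
      rw [Finset.sum_comm]
      refine Fintype.sum_congr _ _ fun y => ?_
      rw [Finset.sum_comm]
    have h2 : ∀ x y : F, (∑ z : F, ∑ t : F,
        if x ^ 3 * a₁ + y ^ 3 * a₂ + z ^ 3 * a₃ = 0 then χ (t * (x + y + z)) else 0) =
        q * if x ^ 3 * a₁ + y ^ 3 * a₂ + (x + y) ^ 3 * a₃ = 0 then 1 else 0 := by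
      intro x y
      have h3 : ∀ z, (∑ t : F,
          if x ^ 3 * a₁ + y ^ 3 * a₂ + z ^ 3 * a₃ = 0 then χ (t * (x + y + z)) else 0) =
          if x + y = z then
            (if x ^ 3 * a₁ + y ^ 3 * a₂ + z ^ 3 * a₃ = 0 then q else 0) else 0 := by
        intro z
        have hxy : x + y = z ↔ x + y + z = 0 := add_eq_zero_iff_eq_of_char_two.symm
        simp only [hxy]
        by_cases hz : x ^ 3 * a₁ + y ^ 3 * a₂ + z ^ 3 * a₃ = 0
        · simp only [if_pos hz, hχ.sum_mul, hq]
        · simp [if_neg hz]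
      rw [Fintype.sum_congr _ _ h3, Finset.sum_ite_eq, if_pos (Finset.mem_univ _), mul_ite,
        mul_one, mul_zero]
    simp only [h1, h2, ← Finset.mul_sum, h]
  have hsplit : ∑ t, T t = T 0 + (q - 1) * S := by
    rw [← Finset.add_sum_erase _ _ (Finset.mem_univ (0 : F)),
      Finset.sum_congr rfl fun t ht => hT t (Finset.ne_of_mem_erase ht), Finset.sum_const,
      nsmul_eq_mul, Finset.card_erase_of_mem (Finset.mem_univ _), Finset.card_univ,
      Nat.cast_pred Fintype.card_pos]
  rw [hsum, hT0] at hsplit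
  have : (q - 1) * S = 0 := by linear_combination -hsplit
  exact (mul_eq_zero.mp this).resolve_left (by omega)

/-- In the new variable `u = (y ^ (Q + 1))⁻¹` the three cubic coefficients are linear in `u`, so
summing over `u` restricts to a diagonal cubic. Coprimality of `k` and `n` gives `c₁ * c₂ ^ Q + c₂ *
c₁ ^ Q ≠ 0`. -/
theorem sum_prod_cubicSum (hχ : IsTraceSign χ) (hn : Odd n) (hF : Fintype.card F = 2 ^ n)
    (hk : k.Coprime n) {W : F → ℤ}
    (hW : ∀ y, W y = if y = 0 then 0 else cubicSum χ (y ^ (2 ^ k + 1))) {c₁ c₂ : F} (h₁ : c₁ ≠ 0)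
    (h₂ : c₂ ≠ 0) (h₃ : c₁ + c₂ ≠ 0) :
    ∑ y, W (c₁ * y) * W (c₂ * y) * W ((c₁ + c₂) * y) = 0 := by
  have h3 : Nat.Coprime 3 (Fintype.card F - 1) :=
    hF ▸ coprime_two_pow_add_one (i := 1) hn (Nat.coprime_one_left n)
  have hbij := pow_bijective_of_coprime (F := F) (Nat.succ_ne_zero (2 ^ k))
    (hF ▸ coprime_two_pow_add_one hn hk)
  let G : F → F → ℤ := fun c u => ∑ z, χ (z ^ 3 * (c ^ (2 ^ k + 1))⁻¹ * u + z)
  have hG : ∀ c y : F, c ≠ 0 → W (c * y) = G c (y ^ (2 ^ k + 1))⁻¹ := by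
    intro c y hc
    rw [hW]
    split_ifs with hy
    -- With `0⁻¹ = 0`, the formula also covers `y = 0`: both sides vanish there.
    · have hy0 : y = 0 := (mul_eq_zero.mp hy).resolve_left hc
      simp [G, hy0, hχ.sum_eq_zero]
    · rw [hχ.cubicSum_eq_sum_inv (pow_ne_zero _ hy), mul_pow, mul_inv]
      simp only [G, mul_assoc]
  have hd : c₁ * c₂ ^ 2 ^ k + c₂ * c₁ ^ 2 ^ k ≠ 0 := by
    intro h
    have hr : c₂ * c₁⁻¹ ≠ 0 := mul_ne_zero h₂ (inv_ne_zero h₁)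
    have h4 : (c₂ * c₁⁻¹) ^ (2 ^ k - 1) = 1 := by
      refine mul_right_cancel₀ hr ?_
      rw [← pow_succ, Nat.sub_add_cancel Nat.one_le_two_pow, one_mul, mul_pow, inv_pow,
        mul_inv_eq_iff_eq_mul₀ (pow_ne_zero _ h₁)]
      refine mul_left_cancel₀ h₁ ?_
      rw [add_eq_zero_iff_eq_of_char_two.mp h]
      field_simp
    have h5 := FiniteField.pow_card_sub_one_eq_one _ hr
    rw [hF] at h5
    have h6 := (pow_eq_one_iff_of_coprime (two_pow_sub_one_coprime hk)).mp ⟨h4, h5⟩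
    rw [mul_inv_eq_one₀ h₁] at h6
    exact h₃ (add_eq_zero_iff_eq_of_char_two.mpr h6.symm)
  have H₃ : c₁ ^ 2 ^ k + c₂ ^ 2 ^ k ≠ 0 := by
    rw [← add_pow_two_pow_of_char_two]
    exact pow_ne_zero _ h₃
  have hline := card_diagonal_cubic_line h3 h₁ h₂ h₃ (pow_ne_zero (2 ^ k) h₁)
    (pow_ne_zero (2 ^ k) h₂) H₃ hd
  rw [← add_pow_two_pow_of_char_two] at hline
  simp only [← pow_succ] at hline
  have hS := hχ.sum_diagonal_cubic h3 (inv_ne_zero (pow_ne_zero _ h₃)) hline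
  have h4 : ∀ y, W (c₁ * y) * W (c₂ * y) * W ((c₁ + c₂) * y) =
      G c₁ (y ^ (2 ^ k + 1))⁻¹ * G c₂ (y ^ (2 ^ k + 1))⁻¹ * G (c₁ + c₂) (y ^ (2 ^ k + 1))⁻¹ :=
    fun y => by rw [hG c₁ y h₁, hG c₂ y h₂, hG _ y h₃]
  rw [Fintype.sum_congr _ _ h4,
    hbij.sum_comp fun u => G c₁ u⁻¹ * G c₂ u⁻¹ * G (c₁ + c₂) u⁻¹,
    inv_involutive.bijective.sum_comp fun u => G c₁ u * G c₂ u * G (c₁ + c₂) u]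
  have h5 : ∀ u, G c₁ u * G c₂ u * G (c₁ + c₂) u = ∑ x, ∑ y, ∑ z, χ (x + y + z) *
      χ (u * (x ^ 3 * (c₁ ^ (2 ^ k + 1))⁻¹ + y ^ 3 * (c₂ ^ (2 ^ k + 1))⁻¹ +
        z ^ 3 * ((c₁ + c₂) ^ (2 ^ k + 1))⁻¹)) := by
    intro u
    simp only [G]
    rw [Finset.sum_mul_sum, Finset.sum_mul]
    refine Fintype.sum_congr _ _ fun x => ?_
    rw [Finset.sum_mul]
    refine Fintype.sum_congr _ _ fun y => ?_
    rw [Finset.mul_sum]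
    refine Fintype.sum_congr _ _ fun z => ?_
    simp only [← AddChar.map_add_eq_mul]
    generalize ((c₁ + c₂) ^ (2 ^ k + 1))⁻¹ = a
    congr 1
    ring
  have h6 : ∑ u, G c₁ u * G c₂ u * G (c₁ + c₂) u = ∑ x, ∑ y, ∑ z, ∑ u, χ (x + y + z) *
      χ (u * (x ^ 3 * (c₁ ^ (2 ^ k + 1))⁻¹ + y ^ 3 * (c₂ ^ (2 ^ k + 1))⁻¹ +
        z ^ 3 * ((c₁ + c₂) ^ (2 ^ k + 1))⁻¹)) := by
    rw [Fintype.sum_congr _ _ h5, Finset.sum_comm]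
    refine Fintype.sum_congr _ _ fun x => ?_
    rw [Finset.sum_comm]
    refine Fintype.sum_congr _ _ fun y => ?_
    rw [Finset.sum_comm]
  rw [h6]
  simp only [← Finset.mul_sum, hχ.sum_mul, mul_ite, mul_zero]
  simp only [← ite_zero_mul, ← Finset.sum_mul, hS, zero_mul]

end IsTraceSign

/-! ### Correlations of the block sign along affine maps -/

section

variable {F : Type*} [Field F]

theorem blockSign_eq_iff {n k : ℕ} {x y : F} : blockSign F n k x = blockSign F n k y ↔
    (x ∈ kasamiBlock F n k ↔ y ∈ kasamiBlock F n k) := by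
  rw [blockSign, blockSign]
  split_ifs with h1 h2 h2 <;> simp [h1, h2]

theorem sum_affine_pair [Fintype F] {s t : F} (hst : s ≠ t) (g : F → F → ℤ) :
    ∑ a, ∑ b, g (a * s + b) (a * t + b) = ∑ x, ∑ y, g x y := by
  rw [← Fintype.sum_prod_type', ← Fintype.sum_prod_type']
  have hbij : Function.Bijective fun p : F × F => (p.1 * s + p.2, p.1 * t + p.2) := by
    refine Finite.injective_iff_bijective.mp ?_
    rintro ⟨a, b⟩ ⟨c, d⟩ h
    simp only [Prod.mk.injEq] at h ⊢
    have hac : a = c := by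
      refine mul_right_cancel₀ (sub_ne_zero.mpr hst) ?_
      linear_combination h.1 - h.2
    subst hac
    exact ⟨rfl, add_left_cancel h.1⟩
  exact hbij.sum_comp fun p => g p.1 p.2

end

namespace IsTraceSign

variable {F : Type*} [Field F] [CharP F 2] [Fintype F] [DecidableEq F] {χ : AddChar F ℤ} {n k : ℕ}

theorem sum_blockSign (hχ : IsTraceSign χ) (hn : Odd n) (hn1 : 1 < n)
    (hF : Fintype.card F = 2 ^ n) (hk : k.Coprime n) : ∑ w, blockSign F n k w = 0 := by
  simpa using hχ.sum_blockSign_mul hn hn1 hF hk 0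

theorem sum_blockSign_affine_triple (hχ : IsTraceSign χ) (hn : Odd n) (hn1 : 1 < n)
    (hF : Fintype.card F = 2 ^ n) (hk : k.Coprime n) {r s t : F} (hrs : r ≠ s) (hrt : r ≠ t)
    (hst : s ≠ t) :
    ∑ a, ∑ b, blockSign F n k (a * r + b) * blockSign F n k (a * s + b) *
      blockSign F n k (a * t + b) = 0 := by
  set f := blockSign F n k
  have h₁ : s + t ≠ 0 := add_eq_zero_iff_eq_of_char_two.not.mpr hst
  have h₂ : r + t ≠ 0 := add_eq_zero_iff_eq_of_char_two.not.mpr hrt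
  have h₃ : s + t + (r + t) ≠ 0 := by
    have e : s + t + (r + t) = r + s := by
      linear_combination t * (CharTwo.two_eq_zero : (2 : F) = 0)
    rw [e]
    exact add_eq_zero_iff_eq_of_char_two.not.mpr hrs
  have hW := hχ.sum_prod_cubicSum hn hF hk (hχ.sum_blockSign_mul hn hn1 hF hk) h₁ h₂ h₃
  set c := s + t
  set d := r + t
  have hq : (Fintype.card F : ℤ) ≠ 0 := Nat.cast_ne_zero.mpr Fintype.card_ne_zero
  -- The images `x, y, z` of `r, s, t` satisfy `c * x + d * y + (c + d) * z = 0`, so the third is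
  -- determined by the first two, which range freely over all pairs.
  have hpt : ∀ a b : F, f (a * r + b) * f (a * s + b) * f (a * t + b) =
      f (a * r + b) * f (a * s + b) * f ((c + d)⁻¹ * (c * (a * r + b) + d * (a * s + b))) := by
    intro a b
    congr 2
    rw [eq_inv_mul_iff_mul_eq₀ h₃]
    simp only [c, d]
    linear_combination (a * t * t - a * r * s) * (CharTwo.two_eq_zero : (2 : F) = 0)
  simp only [hpt]
  rw [sum_affine_pair hrs fun x y => f x * f y * f ((c + d)⁻¹ * (c * x + d * y))]
  refine (mul_eq_zero.mp (?_ : (Fintype.card F : ℤ) * _ = 0)).resolve_left hq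
  rw [← hW, Finset.mul_sum]
  have h4 : ∀ u, (∑ w, f w * χ (c * u * w)) * (∑ w, f w * χ (d * u * w)) *
      (∑ w, f w * χ ((c + d) * u * w)) = ∑ x, ∑ y, ∑ z, f x * f y * f z *
        χ (u * (c * x + d * y + (c + d) * z)) := by
    intro u
    rw [Finset.sum_mul_sum, Finset.sum_mul]
    refine Fintype.sum_congr _ _ fun x => ?_
    rw [Finset.sum_mul]
    refine Fintype.sum_congr _ _ fun y => ?_
    rw [Finset.mul_sum]
    refine Fintype.sum_congr _ _ fun z => ?_
    have e : u * (c * x + d * y + (c + d) * z) = c * u * x + d * u * y + (c + d) * u * z := by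
      ring
    rw [e, AddChar.map_add_eq_mul, AddChar.map_add_eq_mul]
    ring
  have h5 : ∑ u, (∑ w, f w * χ (c * u * w)) * (∑ w, f w * χ (d * u * w)) *
      (∑ w, f w * χ ((c + d) * u * w)) = ∑ x, ∑ y, ∑ z, ∑ u, f x * f y * f z *
        χ (u * (c * x + d * y + (c + d) * z)) := by
    rw [Fintype.sum_congr _ _ h4, Finset.sum_comm]
    refine Fintype.sum_congr _ _ fun x => ?_
    rw [Finset.sum_comm]
    refine Fintype.sum_congr _ _ fun y => ?_
    rw [Finset.sum_comm]
  refine Eq.trans ?_ h5.symm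
  refine Fintype.sum_congr _ _ fun x => ?_
  rw [Finset.mul_sum]
  refine Fintype.sum_congr _ _ fun y => ?_
  have h6 : ∀ z, c * x + d * y + (c + d) * z = 0 ↔ (c + d)⁻¹ * (c * x + d * y) = z := fun z => by
    rw [add_eq_zero_iff_eq_of_char_two, inv_mul_eq_iff_eq_mul₀ h₃]
  simp only [← Finset.mul_sum, hχ.sum_mul, h6, mul_ite, mul_zero, Finset.sum_ite_eq,
    Finset.mem_univ, if_true]
  ring

theorem two_mul_ncard_kasamiBlock (hχ : IsTraceSign χ) (hn : Odd n) (hn1 : 1 < n)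
    (hF : Fintype.card F = 2 ^ n) (hk : k.Coprime n) : 2 * (kasamiBlock F n k).ncard = 2 ^ n := by
  classical
  have h1 : ∀ w, (2 : ℤ) * (if w ∈ kasamiBlock F n k then 1 else 0) = 1 - blockSign F n k w :=
    fun w => by
      rw [blockSign]
      split_ifs <;> rfl
  have h2 := Fintype.sum_congr _ _ h1
  rw [← Finset.mul_sum, Finset.sum_sub_distrib, hχ.sum_blockSign hn hn1 hF hk,
    ← Finset.sum_filter] at h2
  rw [Set.ncard_eq_toFinset_card', ← Set.filter_mem_univ_eq_toFinset]
  simp only [Finset.sum_const, nsmul_eq_mul, mul_one, Finset.card_univ, hF, sub_zero] at h2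
  exact_mod_cast h2

/-- The number of affine maps which take a given triple of points into the Kasami block. -/
theorem ncard_affine_triple (hχ : IsTraceSign χ) (hn : Odd n) (hn1 : 1 < n)
    (hF : Fintype.card F = 2 ^ n) (hk : k.Coprime n) {r s t : F} (hrs : r ≠ s) (hrt : r ≠ t)
    (hst : s ≠ t) :
    8 * {p : F × F | p.1 ≠ 0 ∧ p.1 * r + p.2 ∈ kasamiBlock F n k ∧
      p.1 * s + p.2 ∈ kasamiBlock F n k ∧ p.1 * t + p.2 ∈ kasamiBlock F n k}.ncard =
      2 ^ n * (2 ^ n - 4) := by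
  classical
  have hq : 4 ≤ 2 ^ n := Nat.pow_le_pow_right two_pos hn1
  set f := blockSign F n k with hf
  have hf0 : ∑ w, f w = 0 := hχ.sum_blockSign hn hn1 hF hk
  have hshift : ∀ c : F, ∑ b, f (c + b) = 0 := fun c => by
    rw [← hf0]
    exact Equiv.sum_comp (Equiv.addLeft c) f
  have hpair : ∀ {x y : F}, x ≠ y → ∑ a, ∑ b, f (a * x + b) * f (a * y + b) = 0 := by
    intro x y hxy
    rw [sum_affine_pair hxy fun u v => f u * f v, ← Finset.sum_mul_sum, hf0, zero_mul]
  have htriple : ∑ a, ∑ b, f (a * r + b) * f (a * s + b) * f (a * t + b) = 0 :=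
    hχ.sum_blockSign_affine_triple hn hn1 hF hk hrs hrt hst
  -- Constant maps must be removed: for `a = 0` the product is `(1 - f b) ^ 3 = 4 * (1 - f b)`,
  -- because `1 - f b` is `0` or `2`.
  have hdiag : (∑ a : F, ∑ b : F, if a = 0 then 4 * (1 - f b) else 0) = 4 * 2 ^ n := by
    rw [Finset.sum_comm]
    simp only [Finset.sum_ite_eq', Finset.mem_univ, if_true, ← Finset.mul_sum,
      Finset.sum_sub_distrib, hf0]
    simp [hF]
  have hind : ∀ p : F × F, (8 : ℤ) * (if p.1 ≠ 0 ∧ p.1 * r + p.2 ∈ kasamiBlock F n k ∧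
      p.1 * s + p.2 ∈ kasamiBlock F n k ∧ p.1 * t + p.2 ∈ kasamiBlock F n k then 1 else 0) =
      (1 - f (p.1 * r + p.2)) * (1 - f (p.1 * s + p.2)) * (1 - f (p.1 * t + p.2)) -
        if p.1 = 0 then 4 * (1 - f p.2) else 0 := by
    rintro ⟨a, b⟩
    by_cases ha : a = 0
    · simp only [hf, ha, blockSign, zero_mul, zero_add]
      split_ifs <;> simp_all
    · simp only [hf, ha, blockSign]
      split_ifs <;> simp_all
  have h1 := Fintype.sum_congr _ _ hind
  rw [← Finset.mul_sum, Finset.sum_sub_distrib, ← Finset.sum_filter, Fintype.sum_prod_type,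
    Fintype.sum_prod_type] at h1
  have h2 : ∀ a b : F, (1 - f (a * r + b)) * (1 - f (a * s + b)) * (1 - f (a * t + b)) =
      1 - f (a * r + b) - f (a * s + b) - f (a * t + b) + f (a * r + b) * f (a * s + b) +
        f (a * r + b) * f (a * t + b) + f (a * s + b) * f (a * t + b) -
        f (a * r + b) * f (a * s + b) * f (a * t + b) := fun a b => by ring
  simp only [h2, Finset.sum_add_distrib, Finset.sum_sub_distrib, hpair hrs, hpair hrt, hpair hst,
    hshift, htriple, hdiag, Finset.sum_const, Finset.card_univ, hF, nsmul_eq_mul, mul_one] at h1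
  rw [Set.ncard_eq_toFinset_card', Set.toFinset_ofPred]
  zify [hq]
  rw [h1]
  push_cast
  ring

/-- Invariance gives `W y = χ (y * b) * W (y * a)`. Squaring kills the sign, so `χ (ρ y) = χ (ρ y *
ρ a)` for all `y` and `a = 1`. Then `χ (y * b) = 1` wherever `W y ≠ 0`, which is too often if `b ≠
0`. -/
theorem eq_one_and_eq_zero_of_blockSign_affine (hχ : IsTraceSign χ) (hn : Odd n) (hn1 : 1 < n)
    (hF : Fintype.card F = 2 ^ n) (hk : k.Coprime n) {a b : F} (ha : a ≠ 0)
    (hab : ∀ x, blockSign F n k (a * x + b) = blockSign F n k x) : a = 1 ∧ b = 0 := by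
  obtain ⟨ρ, hρ, hρ3⟩ := exists_cube_eq_pow hn hF hk
  have h3 : Nat.Coprime 3 (Fintype.card F - 1) :=
    hF ▸ coprime_two_pow_add_one (i := 1) hn (Nat.coprime_one_left n)
  have hcube := pow_bijective_of_coprime (F := F) three_ne_zero h3
  have hq : (2 : ℤ) ^ n ≠ 0 := by positivity
  set f := blockSign F n k
  let W : F → ℤ := fun y => ∑ w, f w * χ (y * w)
  have hρ0 : ρ 0 = 0 := by simpa using hρ3 0
  have hρmul : ∀ x y, ρ (x * y) = ρ x * ρ y := fun x y => by
    refine hcube.injective ?_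
    rw [mul_pow, hρ3, hρ3, hρ3, mul_pow]
  have hWsq : ∀ y, W y ^ 2 = 2 ^ n * (1 - χ (ρ y)) := by
    intro y
    simp only [W]
    rw [hχ.sum_blockSign_mul hn hn1 hF hk]
    split_ifs with hy
    · simp [hy, hρ0]
    · exact hχ.cubicSum_pow_sq hn hF (hρ3 y) (pow_ne_zero _ hy)
  have hWtrans : ∀ y, W y = χ (y * b) * W (y * a) := by
    intro y
    have hbij : Function.Bijective fun x : F => a * x + b :=
      ((Equiv.mulLeft₀ a ha).trans (Equiv.addRight b)).bijective
    simp only [W]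
    rw [← hbij.sum_comp fun w => f w * χ (y * w), Finset.mul_sum]
    refine Fintype.sum_congr _ _ fun x => ?_
    rw [hab, mul_add, AddChar.map_add_eq_mul, mul_assoc]
    ring
  have h1 : ∀ y, χ (ρ y) = χ (ρ y * ρ a) := by
    intro y
    have e : W y ^ 2 = W (y * a) ^ 2 := by
      rw [hWtrans y, mul_pow, sq (χ _), map_mul_self, one_mul]
    rw [hWsq, hWsq, hρmul] at e
    have := mul_left_cancel₀ hq e
    linarith
  have h2 : ρ a = 1 := by
    have h4 : ∑ u, χ (u * (1 + ρ a)) = Fintype.card F := by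
      have e : ∀ u, χ (u * (1 + ρ a)) = 1 := fun u => by
        obtain ⟨y, rfl⟩ := hρ.surjective u
        rw [mul_add, mul_one, AddChar.map_add_eq_mul, ← h1, map_mul_self]
      simp [e]
    rw [hχ.sum_mul] at h4
    by_contra hne
    rw [if_neg fun h => hne (add_eq_zero_iff_eq_of_char_two.mp h).symm] at h4
    exact Fintype.card_ne_zero (by exact_mod_cast h4.symm)
  have ha1 : a = 1 := by
    refine hρ.injective (h2.trans (hcube.injective ?_))
    rw [hρ3, one_pow, one_pow]
  refine ⟨ha1, ?_⟩
  by_contra hb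
  have h5 : ∀ y, (1 - χ (ρ y)) * (1 - χ (y * b)) = 0 := by
    intro y
    have e := hWtrans y
    rw [ha1, mul_one] at e
    have e2 : W y ^ 2 * (1 - χ (y * b)) = 0 := by linear_combination W y * e
    rw [hWsq, mul_assoc] at e2
    exact (mul_eq_zero.mp e2).resolve_left hq
  -- If `b ≠ 0`, both characters on the right of `e` sum to zero. The terms on the left are
  -- nonnegative, yet the one at `y = 0` is `2`.
  have h6 : ∑ y, (1 + χ (ρ y) * χ (y * b)) = 0 := by
    have e : ∀ y, 1 + χ (ρ y) * χ (y * b) = χ (ρ y) + χ (y * b) := fun y => by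
      linear_combination h5 y
    rw [Fintype.sum_congr _ _ e, Finset.sum_add_distrib, hρ.sum_comp fun u => χ u,
      hχ.sum_eq_zero, hχ.sum_mul, if_neg hb, add_zero]
  have h7 : ∀ y ∈ Finset.univ, 0 ≤ 1 + χ (ρ y) * χ (y * b) := by
    intro y _
    have e : (χ (ρ y) * χ (y * b)) * (χ (ρ y) * χ (y * b)) = 1 := by
      rw [mul_mul_mul_comm, map_mul_self, map_mul_self, one_mul]
    rcases mul_self_eq_one_iff.mp e with h | h <;> rw [h] <;> norm_num
  have h8 := (Finset.sum_eq_zero_iff_of_nonneg h7).mp h6 0 (Finset.mem_univ 0)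
  rw [hρ0, zero_mul, AddChar.map_zero_eq_one] at h8
  norm_num at h8

end IsTraceSign

/-! ### The design -/

theorem mem_orbit_generalAffineGroup_iff {F : Type*} [Field F] {B S : Set F} :
    S ∈ MulAction.orbit (generalAffineGroup F) B ↔
      ∃ a b : F, a ≠ 0 ∧ S = {x | a * x + b ∈ B} := by
  constructor
  · rintro ⟨g, rfl⟩
    obtain ⟨a, b, ha, hab⟩ := (g⁻¹).2
    refine ⟨a, b, ha, ?_⟩
    ext x
    change x ∈ g • B ↔ _
    rw [Set.mem_smul_set_iff_inv_smul_mem, Set.mem_ofPred_eq, ← hab]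
    rfl
  · rintro ⟨a, b, ha, rfl⟩
    let π : generalAffineGroup F :=
      ⟨(Equiv.mulLeft₀ a ha).trans (Equiv.addRight b), a, b, ha, fun _ => rfl⟩
    refine ⟨π⁻¹, ?_⟩
    ext x
    change x ∈ π⁻¹ • B ↔ _
    rw [Set.mem_smul_set_iff_inv_smul_mem, inv_inv]
    rfl

theorem mainTheorem1 (F : Type*) [Field F] [Finite F] (n i : ℕ) (hF : Nat.card F = 2 ^ n)
    (hn : Odd n) (hn1 : 1 < n) (hi : 0 < i) (hin : Nat.Coprime i n) :
    IsDesign (MulAction.orbit (generalAffineGroup F) (kasamiBlock F n i))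
        3 (2 ^ n) (2 ^ n / 2) (2 ^ n * (2 ^ n - 4) / 8) ∧
      MulAction.stabilizer (generalAffineGroup F) (kasamiBlock F n i) = ⊥ := by
  classical
  have : Fintype F := Fintype.ofFinite F
  have hF' : Fintype.card F = 2 ^ n := by rw [← hF, Nat.card_eq_fintype_card]
  have : CharP F 2 := charP_of_card_eq_prime_pow hF'
  obtain ⟨χ, hχ⟩ := exists_isTraceSign F hn hF
  have hq : 8 ≤ 2 ^ n := by
    have h3 : 3 ≤ n := by
      obtain ⟨m, rfl⟩ := hn
      omega
    exact Nat.pow_le_pow_right (n := 2) two_pos h3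
  set B := kasamiBlock F n i
  have hrigid : ∀ a b : F, a ≠ 0 → (∀ x, a * x + b ∈ B ↔ x ∈ B) → a = 1 ∧ b = 0 :=
    fun a b ha hab => hχ.eq_one_and_eq_zero_of_blockSign_affine hn hn1 hF' hin ha fun x =>
      blockSign_eq_iff.mpr (hab x)
  -- Equal preimages under two affine maps make the block invariant under the composite of one with
  -- the inverse of the other; rigidity then shows that blocks correspond bijectively to pairs `(a,
  -- b)` with `a ≠ 0`.
  have hinj : Set.InjOn (fun p : F × F => {x | p.1 * x + p.2 ∈ B}) {p | p.1 ≠ 0} := by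
    rintro ⟨a, b⟩ (ha : a ≠ 0) ⟨c, d⟩ (hc : c ≠ 0) hS
    have hS' : ∀ x, a * x + b ∈ B ↔ c * x + d ∈ B := fun x => Set.ext_iff.mp hS x
    obtain ⟨h1, h2⟩ := hrigid (a / c) (b - a / c * d) (div_ne_zero ha hc) fun x => by
      have h := hS' ((x - d) / c)
      rw [mul_div_cancel₀ _ hc, sub_add_cancel] at h
      rw [← h]
      ring_nf
    rw [h1, one_mul, sub_eq_zero] at h2
    rw [h2, (div_eq_one_iff_eq hc).mp h1]
  refine ⟨⟨hF, by norm_num, by omega, Nat.div_le_self _ _, ?_, ?_⟩, ?_⟩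
  · rintro _ ⟨g, rfl⟩
    have h : 2 * B.ncard = 2 ^ n := hχ.two_mul_ncard_kasamiBlock hn hn1 hF' hin
    change (g • B).ncard = _
    rw [Set.ncard_smul_set]
    omega
  · intro T hT
    obtain ⟨r, s, t, hrs, hrt, hst, rfl⟩ := Set.ncard_eq_three.mp hT
    have h : 8 * {p : F × F | p.1 ≠ 0 ∧ p.1 * r + p.2 ∈ B ∧ p.1 * s + p.2 ∈ B ∧
        p.1 * t + p.2 ∈ B}.ncard = 2 ^ n * (2 ^ n - 4) :=
      hχ.ncard_affine_triple hn hn1 hF' hin hrs hrt hst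
    have himage : {b ∈ MulAction.orbit (generalAffineGroup F) B | {r, s, t} ⊆ b} =
        (fun p : F × F => {x | p.1 * x + p.2 ∈ B}) '' {p : F × F | p.1 ≠ 0 ∧ p.1 * r + p.2 ∈ B ∧
          p.1 * s + p.2 ∈ B ∧ p.1 * t + p.2 ∈ B} := by
      ext S
      simp only [Set.mem_ofPred_eq, mem_orbit_generalAffineGroup_iff, Set.mem_image, Prod.exists]
      constructor
      · rintro ⟨⟨a, b, ha, rfl⟩, hS⟩
        exact ⟨a, b, ⟨ha, hS (by simp), hS (by simp), hS (by simp)⟩, rfl⟩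
      · rintro ⟨a, b, ⟨ha, h1, h2, h3⟩, rfl⟩
        refine ⟨⟨a, b, ha, rfl⟩, ?_⟩
        rintro x (rfl | rfl | rfl)
        exacts [h1, h2, h3]
    rw [himage, (hinj.mono fun p hp => hp.1).ncard_image]
    omega
  · rw [eq_bot_iff]
    rintro ⟨π, a, b, ha, hab⟩ hπ
    rw [MulAction.mem_stabilizer_iff] at hπ
    obtain ⟨rfl, rfl⟩ := hrigid a b ha fun x => by
      nth_rw 1 [← hπ]
      rw [← hab]
      exact Set.smul_mem_smul_set_iff (a := (⟨π, a, b, ha, hab⟩ : generalAffineGroup F))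
    rw [Subgroup.mem_bot]
    ext x
    simp [hab]
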